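/- Write $\operatorname{Comp}_xS$ for the connected component of $S$ containing $x$; by a component we mean a connected component. A *Jordan disk* is an open simply connected set in $\mathbb C$ whose boundary is a Jordan curve. A *complex box mapping* is a holomorphic map $F\colon\mathcal U\to\mathcal V$ between open sets $\mathcal U\subset\mathcal V\subset\mathbb C$ such that: $F$ has finitely many critical points; $\mathcal V$ is a union of finitely many Jordan disks with disjoint closures; every component $V$ of $\mathcal V$ is either a component of $\mathcal U$, or $V\cap\mathcal U$ is a union of Jordan disks with pairwise disjoint closures, each compactly contained in $V$; and for every component $U$ of $\mathcal U$ the image $F(U)$ is a component of $\mathcal V$ and $F\colon U\to F(U)$ is proper. Let $\operatorname{Crit}(F)$ be the set of critical points and $K(F)=\bigcap_{n\ge0}F^{-n}(\mathcal V)$, where $F^{-n}(\mathcal V)$ is the set of points at which $F^n$ is defined (with $F^0=\mathrm{id}_{\mathcal V}$). A *puzzle piece* is a component of some $F^{-n}(\mathcal V)$, $n\ge0$. $F$ is *dynamically natural* if * (a) for each component $U$ of $\mathcal U$ there is $n\ge0$ with $F^n(U)\setminus\mathcal U\ne\emptyset$; * (b) the set of $x\in K(F)$ for which there is a finite union $W$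 of puzzle pieces with $\operatorname{Crit}(F)\subset W$, such that each component of $W$ meets $\operatorname{Crit}(F)$ and the orbit of $x$ is disjoint from $W$, has zero area; * (c) for every $x\in K(F)$ one has $\limsup_{k\to\infty}m_F(F^k(x))>0$, where $m_F(y)$ is the conformal modulus of $\operatorname{Comp}_y\mathcal V\setminus\overline{\operatorname{Comp}_y\mathcal U}$ (equal to $0$ if $\operatorname{Comp}_y\mathcal U=\operatorname{Comp}_y\mathcal V$). $F$ is *renormalizable* if there are $s\ge1$, a critical point $c$ and a puzzle piece $W\ni c$ such that $F^{ks}(c)$ is defined and belongs to $W$ for all $k\ge0$. A *measurable invariant line field supported on $K(F)$* is a measurable set $E\subset K(F)$ of positive area with $F^{-1}(E)=E$ and $\operatorname{area}(K(F)\setminus E)=0$, together with a real line through each $z\in E$ whose slope depends measurably on $z$, such that for every $z\in E$ the differential $D_zF$ maps the line at $z$ onto the line at $F(z)$. **Proposition (Lattès box mappings exist).** There exists a dynamically natural complex box mapping $F\colon\mathcal U\to\mathcal V$ which is not renormalizable, such that $\operatorname{area}(K(F))>0$, which carries a measurable invariant line field supported on $K(F)$, and such that moreover: 1. $\operatorname{Crit}(F)=\{c\}$,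 $F^2(c)=F(c)$ and $F(c)\neq c$, i.e. the unique critical point is strictly pre-fixed; 2. $\mathcal V$ consists of exactly two components $V\ne V'$, with $\mathcal U\cap V=V$ and $c\in V$, and $F(c)$ lies in a component $U'$ of $\mathcal U\cap V'$; 3. $\mathcal U\cap V'$ has infinitely many components, and they tile $V'$, i.e. $\operatorname{area}(V'\setminus\mathcal U)=0$; 4. $F(U')=V'$, and $F(U'')=V$ for each component $U''\neq U'$ of $\mathcal U\cap V'$. -/

import Mathlib

open Set Filter Topology MeasureTheory

noncomputable section

namespace BoxMapping

/-- The connected components of a subset of the plane. -/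
def components (S : Set ℂ) : Set (Set ℂ) :=
  {C | ∃ x ∈ S, C = connectedComponentIn S x}

/-- A Jordan disk: an open simply connected set whose boundary is a Jordan curve. -/
def IsJordanDisk (D : Set ℂ) : Prop :=
  IsOpen D ∧ IsSimplyConnected D ∧
    ∃ γ : Circle → ℂ, Continuous γ ∧ Function.Injective γ ∧ range γ = frontier D

/-- A closed `C¹` curve with image in `A`, parametrized by `ℝ` with period `1`. -/
def IsClosedCurveIn (A : Set ℂ) (γ : ℝ → ℂ) : Prop :=
  ContDiff ℝ 1 γ ∧ Function.Periodic γ 1 ∧ ∀ t, γ t ∈ A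

/-- The integral `∮ dz / (z - p)` along `γ`, i.e. `2πi` times the winding number about `p`. -/
def windingIntegral (γ : ℝ → ℂ) (p : ℂ) : ℂ :=
  ∫ t in (0 : ℝ)..1, deriv γ t / (γ t - p)

/-- A closed curve in `A` is essential if it winds around some point outside `A`. If `A` is
an annulus, these are exactly the closed curves in `A` which are not null-homotopic in `A`. -/
def IsEssentialCurve (A : Set ℂ) (γ : ℝ → ℂ) : Prop :=
  IsClosedCurveIn A γ ∧ ∃ p ∉ A, windingIntegral γ p ≠ 0

/-- The length of `γ` in the conformal metric `ρ |dz|`. -/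
def metricLength (ρ : ℂ → ENNReal) (γ : ℝ → ℂ) : ENNReal :=
  ∫⁻ t in Icc (0 : ℝ) 1, ρ (γ t) * ‖deriv γ t‖ₑ

/-- The conformal modulus of an annulus `A`, as the modulus of the family of its essential
closed curves: the infimum of the areas of the conformal metrics for which every such curve
has length at least one. The round annulus `r < |z| < R` has modulus `log (R / r) / (2π)`,
and the degenerate annulus `∅` has modulus `0`. -/
def modulus (A : Set ℂ) : ENNReal :=
  ⨅ ρ ∈ {ρ : ℂ → ENNReal | Measurable ρ ∧
      ∀ γ : ℝ → ℂ, IsEssentialCurve A γ → 1 ≤ metricLength ρ γ},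
    ∫⁻ z in A, ρ z ^ 2

end BoxMapping

open BoxMapping

/-- A complex box mapping `F : U → V`. The map is a total function on `ℂ` of which only the
values on `U` are meaningful. -/
structure ComplexBoxMapping where
  /-- the domain -/
  U : Set ℂ
  /-- the range -/
  V : Set ℂ
  /-- the map -/
  f : ℂ → ℂ
  isOpen_U : IsOpen U
  isOpen_V : IsOpen V
  U_subset_V : U ⊆ V
  mapsTo : MapsTo f U V
  holomorphic : DifferentiableOn ℂ f U
  /-- finitely many critical points -/
  finite_crit : {z ∈ U | deriv f z = 0}.Finite
  /-- `V` is a finite union of open Jordan disks with disjoint closures -/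
  V_eq : ∃ D : Set (Set ℂ), D.Finite ∧ (∀ A ∈ D, IsJordanDisk A) ∧
    D.PairwiseDisjoint closure ∧ V = ⋃₀ D
  /-- a component `A` of `V` is a component of `U`, or `A ∩ U` is a union of Jordan disks with
  pairwise disjoint closures, each compactly contained in `A` -/
  U_inter : ∀ A ∈ components V, A ∈ components U ∨
    ∃ D : Set (Set ℂ), (∀ B ∈ D, IsJordanDisk B ∧ closure B ⊆ A) ∧
      D.PairwiseDisjoint closure ∧ A ∩ U = ⋃₀ D
  /-- each component of `U` is mapped onto a component of `V` -/
  image_mem : ∀ B ∈ components U, f '' B ∈ components V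
  /-- the restrictions `F : B → F(B)` to components `B` of `U` are proper -/
  isProperMap : ∀ B ∈ components U, IsProperMap ((mapsTo_image f B).restrict f B (f '' B))

namespace ComplexBoxMapping

variable (F : ComplexBoxMapping)

/-- The critical points of `F`. -/
def Crit : Set ℂ := {z ∈ F.U | deriv F.f z = 0}

/-- `F⁻ⁿ(V)`: the set of points at which the `n`-th iterate of `F` is defined. On this set it is
given by `F.f^[n]`. -/
def preimageV : ℕ → Set ℂ
  | 0 => F.V
  | n + 1 => F.U ∩ F.f ⁻¹' preimageV n

/-- The filled Julia set (non-escaping set) `K(F)`. -/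
def K : Set ℂ := ⋂ n, F.preimageV n

/-- The puzzle pieces of depth `n`. -/
def puzzlePieces (n : ℕ) : Set (Set ℂ) := components (F.preimageV n)

/-- The forward orbit of a non-escaping point. -/
def orbit (x : ℂ) : Set ℂ := range fun n : ℕ => F.f^[n] x

/-- The image `Fⁿ(B)`, i.e. the set of `Fⁿ(x)` for those `x ∈ B` at which `Fⁿ` is defined. -/
def iterImage (n : ℕ) (B : Set ℂ) : Set ℂ := F.f^[n] '' (B ∩ F.preimageV n)

/-- `W` is a puzzle neighborhood of `A`: a finite union of puzzle pieces (of any depths) that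
contains `A` and each component of which meets `A`. -/
def IsPuzzleNeighborhood (A W : Set ℂ) : Prop :=
  (∃ S : Set (Set ℂ), S.Finite ∧ (∀ P ∈ S, ∃ n, P ∈ F.puzzlePieces n) ∧ W = ⋃₀ S) ∧
    A ⊆ W ∧ ∀ C ∈ components W, (C ∩ A).Nonempty

/-- The non-escaping points whose orbit avoids some puzzle neighborhood of the critical points.
If there are no critical points, this is all of `K(F)` (take `W = ∅`). -/
def KOffCrit : Set ℂ :=
  {x ∈ F.K | ∃ W, F.IsPuzzleNeighborhood F.Crit W ∧ F.orbit x ∩ W = ∅}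

/-- `m_F(x)`: the modulus of the component of `V` at `x` minus the closure of the component of
`U` at `x`; it is zero if these components coincide. -/
def m (x : ℂ) : ENNReal :=
  modulus (connectedComponentIn F.V x \ closure (connectedComponentIn F.U x))

/-- The non-escaping points whose orbit visits, infinitely often, components of `U` that are
`δ`-well-inside `V`, for some `δ > 0`. -/
def KWellInside : Set ℂ :=
  ⋃ δ : {δ : ℝ // 0 < δ},
    {y ∈ F.K | ENNReal.ofReal δ < limsup (fun k : ℕ => F.m (F.f^[k] y)) atTop}

/-- The no permutation condition. -/
def NoPermutation : Prop :=
  ∀ B ∈ components F.U, ∃ n, (F.iterImage n B \ F.U).Nonempty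

/-- Dynamically natural box mappings. -/
def IsDynamicallyNatural : Prop :=
  F.NoPermutation ∧ volume F.KOffCrit = 0 ∧ F.K = F.KWellInside

/-- `F` is renormalizable if for some `s ≥ 1` and some puzzle piece `W` that contains a critical
point `c`, the iterates `F^{ks}(c)`, `k ≥ 0`, are all defined and lie in `W`. -/
def IsRenormalizable : Prop :=
  ∃ s : ℕ, 1 ≤ s ∧ ∃ n, ∃ W ∈ F.puzzlePieces n, ∃ c ∈ F.Crit, c ∈ W ∧
    ∀ k : ℕ, c ∈ F.preimageV (k * s) ∧ F.f^[k * s] c ∈ W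

end ComplexBoxMapping

/-- A measurable line field on `B ⊆ ℂ`: a real line through each point of a measurable subset
`E` of `B` of positive area, depending measurably on the point. The line through `z` is recorded
by its direction, a one-dimensional real subspace of `ℂ`. -/
structure LineField (B : Set ℂ) where
  /-- the set of points at which a line is given -/
  E : Set ℂ
  E_subset : E ⊆ B
  nullMeasurableSet_E : NullMeasurableSet E volume
  volume_E_pos : 0 < volume E
  /-- the direction of the line through a point -/
  line : ℂ → Submodule ℝ ℂ
  finrank_line : ∀ z ∈ E, Module.finrank ℝ (line z) = 1
  measurable_line : ∃ v : ℂ → ℂ, AEMeasurable v (volume.restrict E) ∧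
    ∀ z ∈ E, line z = Submodule.span ℝ {v z}

/-- A line field is invariant under `F` if `F⁻¹(E) = E` and the differential of `F` maps the line
at `z` onto the line at `F(z)`, for all `z ∈ E`. -/
def LineField.IsInvariant {B : Set ℂ} (μ : LineField B) (F : ComplexBoxMapping) : Prop :=
  F.U ∩ F.f ⁻¹' μ.E = μ.E ∧
    ∀ z ∈ μ.E, (μ.line z).map (fderiv ℝ F.f z : ℂ →ₗ[ℝ] ℂ) = μ.line (F.f z)

end

open BoxMapping

/-! The map is affine in suitable charts. Use the chart `z - 3` on `V = ball 3 1` and the two-valued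
chart `√w` on `V' = ball 0 1`. Pack the half annulus `1/2 < |z| < 1`, `re z > 0`, by round disks up
to a null set and square them to get tiles in `V'`. The map is `(w - 3)²` on `V`, `4w` on `ball 0
(1/4)`, and on a tile it is `√w` followed by the real affine map of its disk onto `V`. In the charts
these are `z ↦ ±z`, `z ↦ ±2z` and `z ↦ (z - x)/r`. All have real linear part, so the horizontal
direction is preserved; on `V'` it reads as the direction `√w` (`direction_map`). Since `V \ U` is
null and preimages of null sets are null, `K(F)` has full area in the range
(`IsNonsingular.volume_V_diff_K`).

The critical point goes to the fixed point `0` in the other component of the range, which excludes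
renormalization. Every orbit in `K(F)` visits `V'` at least every second step, and there the domain
components have uniformly thick collars (`modulus_bound_of_mem_innerPieces`), whence condition (c).

The main estimate is condition (b) (`volume_avoidingInner_inter_ball`). Measured in the charts, area
is exactly balanced: the central disk carries `1/4` of the inner area, the tiles contribute at most
`3/8` of the outer area, the outer area is at most twice the inner one, and `1/4 + 2 · 3/8 = 1`.
Avoiding a neighbourhood of the critical point loses some area in this balance, so the avoiding set
is null near `0`, and by self-similarity everywhere. -/

namespace BoxMapping

/-! ### Components, Jordan disks and proper maps. -/

theorem components_sUnion {D : Set (Set ℂ)} (hopen : ∀ A ∈ D, IsOpen A)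
    (hconn : ∀ A ∈ D, IsConnected A) (hdisj : D.PairwiseDisjoint id) :
    components (⋃₀ D) = D := by
  have key : ∀ A ∈ D, ∀ x ∈ A, connectedComponentIn (⋃₀ D) x = A := by
    intro A hA x hx
    apply Subset.antisymm
    · have hpre : IsPreconnected (connectedComponentIn (⋃₀ D) x) :=
        isPreconnected_connectedComponentIn
      refine hpre.subset_left_of_subset_union (hopen A hA)
        (isOpen_sUnion fun B (hB : B ∈ D \ {A}) => hopen B hB.1) ?_ ?_ ?_
      · rw [disjoint_sUnion_right]
        exact fun B hB => hdisj hA hB.1 (fun h => hB.2 h.symm)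
      · refine (connectedComponentIn_subset _ _).trans ?_
        rintro y ⟨B, hB, hy⟩
        by_cases h : B = A
        · exact Or.inl (h ▸ hy)
        · exact Or.inr ⟨B, ⟨hB, h⟩, hy⟩
      · exact ⟨x, mem_connectedComponentIn ⟨A, hA, hx⟩, hx⟩
    · exact (hconn A hA).isPreconnected.subset_connectedComponentIn hx (subset_sUnion_of_mem hA)
  ext C
  constructor
  · rintro ⟨x, ⟨A, hA, hx⟩, rfl⟩
    rwa [key A hA x hx]
  · intro hC
    obtain ⟨x, hx⟩ := (hconn C hC).nonempty
    exact ⟨x, ⟨C, hC, hx⟩, (key C hC x hx).symm⟩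

theorem connectedComponentIn_eq_of_mem_components {S C : Set ℂ} {x : ℂ}
    (hC : C ∈ components S) (hx : x ∈ C) : connectedComponentIn S x = C := by
  obtain ⟨y, -, rfl⟩ := hC
  exact (connectedComponentIn_eq hx).symm

theorem closure_image_ball {f : ℂ → ℂ} {x : ℂ} {r : ℝ} (hr : 0 < r)
    (hf : ContinuousOn f (Metric.closedBall x r)) :
    closure (f '' Metric.ball x r) = f '' Metric.closedBall x r := by
  apply Subset.antisymm
  · exact closure_minimal (image_mono Metric.ball_subset_closedBall)
      ((isCompact_closedBall x r).image_of_continuousOn hf).isClosed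
  · rw [← closure_ball x hr.ne'] at hf ⊢
    exact hf.image_closure

/-- By compactness, `f` embeds the closed ball. So the open ball keeps its simple connectivity, and
the frontier of its open image is the image of the boundary circle. -/
theorem isJordanDisk_image_ball {f : ℂ → ℂ} {x : ℂ} {r : ℝ} (hr : 0 < r)
    (hf : ContinuousOn f (Metric.closedBall x r)) (hinj : InjOn f (Metric.closedBall x r))
    (hopen : IsOpen (f '' Metric.ball x r)) : IsJordanDisk (f '' Metric.ball x r) := by
  refine ⟨hopen, ?_, ?_⟩
  · have hemb : IsEmbedding (fun z : Metric.ball x r => f z) := by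
      have h1 : IsEmbedding ((Metric.closedBall x r).domRestrict f) :=
        (hf.domRestrict.isClosedEmbedding (injOn_iff_injective.1 hinj)).isEmbedding
      exact h1.comp (IsEmbedding.inclusion (Metric.ball_subset_closedBall (x := x) (ε := r)))
    have : ContractibleSpace (Metric.ball x r) :=
      (convex_ball x r).contractibleSpace ⟨x, Metric.mem_ball_self hr⟩
    have h2 : IsSimplyConnected (univ : Set (Metric.ball x r)) := by
      have e : (univ : Set (Metric.ball x r)) ≃ₜ Metric.ball x r := Homeomorph.Set.univ _
      exact e.toHomotopyEquiv.simplyConnectedSpace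
    have h3 := (hemb.isSimplyConnected_image (s := univ)).2 h2
    convert h3 using 1
    ext w
    simp
  · refine ⟨fun u => f (x + r * u), ?_, ?_, ?_⟩
    · refine hf.comp_continuous (by fun_prop) fun u => ?_
      simp [abs_of_pos hr, Circle.norm_coe]
    · intro u v huv
      have h := hinj (by simp [abs_of_pos hr, Circle.norm_coe])
        (by simp [abs_of_pos hr, Circle.norm_coe]) huv
      have : (r : ℂ) ≠ 0 := by exact_mod_cast hr.ne'
      exact Circle.ext (by simpa [this] using h)
    · rw [frontier, hopen.interior_eq, closure_image_ball hr hf,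
        ← hinj.image_sdiff_subset Metric.ball_subset_closedBall, Metric.closedBall_sdiff_ball]
      ext w
      constructor
      · rintro ⟨u, rfl⟩
        exact ⟨_, by simp [abs_of_pos hr, Circle.norm_coe], rfl⟩
      · rintro ⟨z, hz, rfl⟩
        have hr' : (r : ℂ) ≠ 0 := by exact_mod_cast hr.ne'
        rw [mem_sphere_iff_norm] at hz
        refine ⟨⟨(z - x) / r, ?_⟩, ?_⟩
        · rw [Submonoid.unitSphere, Submonoid.mem_mk]
          simp [hz, abs_of_pos hr, hr.ne']
        · simp only
          congr 1
          field_simp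
          ring

theorem isJordanDisk_ball {x : ℂ} {r : ℝ} (hr : 0 < r) : IsJordanDisk (Metric.ball x r) := by
  have := isJordanDisk_image_ball (f := id) (x := x) hr continuousOn_id (injOn_id _)
    (by simp)
  simpa using this

theorem isProperMap_restrict_image {f : ℂ → ℂ} {B : Set ℂ} (hf : ContinuousOn f B)
    (h : ∀ k ⊆ f '' B, IsCompact k → IsCompact (B ∩ f ⁻¹' k)) :
    IsProperMap ((mapsTo_image f B).restrict f B (f '' B)) := by
  rw [isProperMap_iff_isCompact_preimage]
  refine ⟨hf.mapsToRestrict _, fun k hk => ?_⟩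
  rw [Subtype.isCompact_iff]
  have := h (Subtype.val '' k) (by simp) (hk.image continuous_subtype_val)
  convert this using 1
  ext z
  constructor
  · rintro ⟨⟨z, hz⟩, hzk, rfl⟩
    exact ⟨hz, _, hzk, rfl⟩
  · rintro ⟨hz, y, hy, hyz⟩
    refine ⟨⟨z, hz⟩, ?_, rfl⟩
    have : (mapsTo_image f B).restrict f B (f '' B) ⟨z, hz⟩ = y := Subtype.ext hyz.symm
    simpa [this] using hy

/-- The preimage of a compact set `k` is `g '' k`. -/
theorem isProperMap_restrict_of_leftInvOn {f g : ℂ → ℂ} {B : Set ℂ} (hf : ContinuousOn f B)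
    (hg : ContinuousOn g (f '' B)) (hgf : LeftInvOn g f B) :
    IsProperMap ((mapsTo_image f B).restrict f B (f '' B)) := by
  refine isProperMap_restrict_image hf fun k hk hc => ?_
  convert hc.image_of_continuousOn (hg.mono hk) using 1
  ext z
  constructor
  · rintro ⟨hz, hzk⟩
    exact ⟨_, hzk, hgf hz⟩
  · rintro ⟨w, hw, rfl⟩
    obtain ⟨y, hy, rfl⟩ := hk hw
    rw [hgf hy]
    exact ⟨hy, hw⟩

/-! ### A lower bound for the modulus by the length-area method. -/

/-- The circle of radius `s` about `p`, parametrized by the unit interval. -/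
noncomputable def circleCurve (p : ℂ) (s : ℝ) (t : ℝ) : ℂ :=
  circleMap p s (2 * Real.pi * t - Real.pi)

theorem hasDerivAt_circleCurve (p : ℂ) (s t : ℝ) : HasDerivAt (circleCurve p s)
    ((2 * Real.pi : ℝ) • (circleMap 0 s (2 * Real.pi * t - Real.pi) * Complex.I)) t := by
  have h1 : HasDerivAt (fun t : ℝ => 2 * Real.pi * t - Real.pi) (2 * Real.pi) t := by
    simpa using ((hasDerivAt_id t).const_mul (2 * Real.pi)).sub_const Real.pi
  exact (hasDerivAt_circleMap p s _).scomp t h1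

theorem contDiff_circleCurve (p : ℂ) (s : ℝ) : ContDiff ℝ 1 (circleCurve p s) :=
  (contDiff_circleMap p s).comp (by fun_prop)

theorem windingIntegral_circleCurve (p : ℂ) {s : ℝ} (hs : 0 < s) :
    windingIntegral (circleCurve p s) p = 2 * Real.pi * Complex.I := by
  have : ∀ t : ℝ, deriv (circleCurve p s) t / (circleCurve p s t - p) =
      2 * Real.pi * Complex.I := by
    intro t
    rw [(hasDerivAt_circleCurve p s t).deriv, circleCurve, circleMap_sub_center]
    have := circleMap_ne_center (c := 0) hs.ne' (θ := 2 * Real.pi * t - Real.pi)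
    rw [Complex.real_smul]
    push_cast
    rw [div_eq_iff this]
    ring
  simp [windingIntegral, this]

theorem isEssentialCurve_circleCurve {A : Set ℂ} {p : ℂ} {s : ℝ} (hs : 0 < s) (hp : p ∉ A)
    (hA : ∀ z, ‖z - p‖ = s → z ∈ A) : IsEssentialCurve A (circleCurve p s) := by
  refine ⟨⟨contDiff_circleCurve p s, fun t => ?_, fun t => hA _ ?_⟩, p, hp, ?_⟩
  · have := periodic_circleMap p s (2 * Real.pi * t - Real.pi)
    rw [circleCurve, circleCurve, ← this]
    congr 1
    ring
  · rw [circleCurve, circleMap_sub_center]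
    simp [abs_of_pos hs]
  · rw [windingIntegral_circleCurve p hs]
    simp [Real.pi_ne_zero]

/-- The angle runs over `[-π, π]` to match the target of `Complex.polarCoord`. -/
theorem metricLength_circleCurve {ρ : ℂ → ENNReal} (p : ℂ) {s : ℝ} (hs : 0 < s) :
    metricLength ρ (circleCurve p s) =
      ∫⁻ θ in Icc (-Real.pi) Real.pi, ENNReal.ofReal s * ρ (circleMap p s θ) := by
  have himage : (fun t : ℝ => 2 * Real.pi * t - Real.pi) '' Icc 0 1 =
      Icc (-Real.pi) Real.pi := by
    ext θ
    constructor
    · rintro ⟨t, ⟨h0, h1⟩, rfl⟩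
      constructor <;> nlinarith [Real.pi_pos]
    · rintro ⟨h0, h1⟩
      have := Real.pi_pos
      refine ⟨(θ + Real.pi) / (2 * Real.pi), ⟨by apply div_nonneg <;> linarith, ?_⟩, ?_⟩
      · rw [div_le_one (by linarith)]
        linarith
      · field_simp
        ring
  rw [← himage, lintegral_image_eq_lintegral_abs_deriv_mul (f' := fun _ => 2 * Real.pi)
    measurableSet_Icc]
  · refine lintegral_congr fun t => ?_
    have hn : ‖deriv (circleCurve p s) t‖ₑ = ENNReal.ofReal (|2 * Real.pi|) * ENNReal.ofReal s := by
      rw [(hasDerivAt_circleCurve p s t).deriv, ← ofReal_norm, norm_smul, norm_mul (circleMap _ _ _),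
        norm_circleMap_zero, abs_of_pos hs, ← ENNReal.ofReal_mul (abs_nonneg _)]
      simp
    rw [hn, circleCurve]
    ring
  · intro t _
    have h1 : HasDerivAt (fun t : ℝ => 2 * Real.pi * t - Real.pi) (2 * Real.pi) t := by
      simpa using ((hasDerivAt_id t).const_mul (2 * Real.pi)).sub_const Real.pi
    exact h1.hasDerivWithinAt
  · intro a _ b _ hab
    have := Real.pi_pos
    simpa [this.ne'] using hab

/-- Cauchy–Schwarz on a circle. -/
theorem inv_le_lintegral_sq_of_one_le_lintegral {g : ℝ → ENNReal} (hg : Measurable g) {s : ℝ}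
    (hs : 0 < s)
    (h : 1 ≤ ∫⁻ θ in Icc (-Real.pi) Real.pi, ENNReal.ofReal s * g θ) :
    ENNReal.ofReal (1 / (2 * Real.pi * s)) ≤
      ∫⁻ θ in Icc (-Real.pi) Real.pi, ENNReal.ofReal s * g θ ^ 2 := by
  have hpi := Real.pi_pos
  rw [lintegral_const_mul _ hg] at h
  rw [lintegral_const_mul _ (by fun_prop)]
  have hcs := ENNReal.lintegral_mul_le_Lp_mul_Lq (volume.restrict (Icc (-Real.pi) Real.pi))
    (p := 2) (q := 2) (by constructor <;> norm_num) hg.aemeasurable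
    (aemeasurable_const (b := (1 : ENNReal)))
  simp only [Pi.mul_apply, mul_one, lintegral_const, one_pow, one_mul,
    Measure.restrict_apply_univ, Real.volume_Icc, ENNReal.rpow_ofNat] at hcs
  set I := ∫⁻ θ in Icc (-Real.pi) Real.pi, g θ
  set J := ∫⁻ θ in Icc (-Real.pi) Real.pi, g θ ^ 2
  have h2 : I ^ 2 ≤ J * ENNReal.ofReal (2 * Real.pi) := by
    calc I ^ 2 ≤ (J ^ (1 / 2 : ℝ) * ENNReal.ofReal (Real.pi - -Real.pi) ^ (1 / 2 : ℝ)) ^ 2 := by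
          gcongr
      _ = J * ENNReal.ofReal (2 * Real.pi) := by
          rw [mul_pow, ← ENNReal.rpow_natCast, ← ENNReal.rpow_natCast, ← ENNReal.rpow_mul,
            ← ENNReal.rpow_mul]
          norm_num [← two_mul]
  have h3 : 1 ≤ ENNReal.ofReal s ^ 2 * (J * ENNReal.ofReal (2 * Real.pi)) := by
    calc (1 : ENNReal) = 1 ^ 2 := by norm_num
      _ ≤ (ENNReal.ofReal s * I) ^ 2 := by gcongr
      _ = ENNReal.ofReal s ^ 2 * I ^ 2 := by ring
      _ ≤ _ := by gcongr
  have h4 : 0 < 2 * Real.pi * s := by positivity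
  rw [one_div, ENNReal.ofReal_inv_of_pos h4, ENNReal.inv_le_iff_le_mul]
  · rw [ENNReal.ofReal_mul (by positivity)]
    calc (1 : ENNReal) ≤ _ := h3
      _ = _ := by ring
  · exact fun _ => by simpa using h4
  · exact fun h => absurd h ENNReal.ofReal_ne_top

/-- Every circle about `p` with radius `s` between `r` and `R` is essential in `A`; apply
Cauchy–Schwarz on each and integrate over `s`. Replacing `1/s` by `1/R` loses the sharp `log (R/r)`,
but a positive bound depending only on `R/r` is all that is needed. -/
theorem ofReal_div_le_modulus {A : Set ℂ} {p : ℂ} {r R : ℝ} (hr : 0 < r)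
    (hR : r < R) (hp : p ∉ A) (hA : ∀ z, r < ‖z - p‖ → ‖z - p‖ < R → z ∈ A) :
    ENNReal.ofReal ((R - r) / (2 * Real.pi * R)) ≤ modulus A := by
  refine le_iInf₂ fun ρ hρ => ?_
  obtain ⟨hm, hadm⟩ := hρ
  have hpi := Real.pi_pos
  have hR0 : 0 < R := hr.trans hR
  set S : Set ℂ := {z | r < ‖z - p‖ ∧ ‖z - p‖ < R} with hS
  have hSm : MeasurableSet S :=
    by
    have hc : Continuous fun z : ℂ => ‖z - p‖ := by fun_prop
    exact ((isOpen_lt continuous_const hc).inter (isOpen_lt hc continuous_const)).measurableSet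
  -- Cutting off to the round annulus lets the polar integral extend over all radii.
  set h : ℂ → ENNReal := S.indicator fun z => ρ z ^ 2 with hh
  have hhm : Measurable h := (hm.pow_const 2).indicator hSm
  calc ENNReal.ofReal ((R - r) / (2 * Real.pi * R))
      = ∫⁻ _s in Ioo r R, ENNReal.ofReal (1 / (2 * Real.pi * R)) := by
        rw [setLIntegral_const, Real.volume_Ioo, ← ENNReal.ofReal_mul (by positivity)]
        congr 1
        ring
    _ ≤ ∫⁻ s in Ioo r R, ∫⁻ θ in Icc (-Real.pi) Real.pi,
          ENNReal.ofReal s * ρ (circleMap p s θ) ^ 2 := by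
        refine setLIntegral_mono' measurableSet_Ioo fun s hs => ?_
        have hs0 : 0 < s := hr.trans hs.1
        have h1 := hadm _ (isEssentialCurve_circleCurve (A := A) hs0 hp
          fun z hz => hA z (hz ▸ hs.1) (hz ▸ hs.2))
        rw [metricLength_circleCurve p hs0] at h1
        refine le_trans ?_ (inv_le_lintegral_sq_of_one_le_lintegral
          (hm.comp (measurable_circleMap p s)) hs0 h1)
        apply ENNReal.ofReal_le_ofReal
        have := hs.2
        gcongr
    _ = ∫⁻ s in Ioo r R, ∫⁻ θ in Ioo (-Real.pi) Real.pi,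
          ENNReal.ofReal s * h (p + Complex.polarCoord.symm (s, θ)) := by
        refine setLIntegral_congr_fun measurableSet_Ioo fun s hs => ?_
        have hs0 : 0 < s := hr.trans hs.1
        rw [restrict_Ioo_eq_restrict_Icc]
        refine lintegral_congr fun θ => ?_
        have he : p + Complex.polarCoord.symm (s, θ) = circleMap p s θ := by
          rw [Complex.polarCoord_symm_apply, circleMap, Complex.exp_mul_I]
          simp
        have hmem : circleMap p s θ ∈ S := by
          simp [hS, abs_of_pos hs0, hs.1, hs.2]
        rw [he, hh, indicator_of_mem hmem]
    _ ≤ ∫⁻ s in Ioi (0 : ℝ), ∫⁻ θ in Ioo (-Real.pi) Real.pi,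
          ENNReal.ofReal s * h (p + Complex.polarCoord.symm (s, θ)) :=
        lintegral_mono_set fun s hs => hr.trans hs.1
    _ = ∫⁻ q in Complex.polarCoord.target,
          ENNReal.ofReal q.1 • h (p + Complex.polarCoord.symm q) := by
        rw [Complex.polarCoord_target, Measure.volume_eq_prod, ← Measure.prod_restrict,
          lintegral_prod]
        · rfl
        · have : Measurable Complex.polarCoord.symm := by
            have : (Complex.polarCoord.symm : ℝ × ℝ → ℂ) =
                fun q => (q.1 : ℂ) * (Real.cos q.2 + Real.sin q.2 * Complex.I) := by
              ext q
              rw [Complex.polarCoord_symm_apply]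
            rw [this]
            fun_prop
          exact (by fun_prop : Measurable _).aemeasurable
    _ = ∫⁻ z, h (p + z) := Complex.lintegral_comp_polarCoord_symm fun z => h (p + z)
    _ = ∫⁻ z, h z := lintegral_add_left_eq_self h p
    _ = ∫⁻ z in S, ρ z ^ 2 := lintegral_indicator hSm _
    _ ≤ ∫⁻ z in A, ρ z ^ 2 := lintegral_mono_set fun z hz => hA z hz.1 hz.2

end BoxMapping

/-! ### The principal square root. -/

namespace Lattes

/-- The principal branch of the square root. -/
noncomputable def csqrt (w : ℂ) : ℂ := w ^ (2⁻¹ : ℂ)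

theorem csqrt_sq (w : ℂ) : csqrt w ^ 2 = w := by
  simp [csqrt]

theorem csqrt_of_sq {z : ℂ} (hz : 0 < z.re) : csqrt (z ^ 2) = z := Complex.sq_cpow_two_inv hz

theorem norm_csqrt_sq (w : ℂ) : ‖csqrt w‖ ^ 2 = ‖w‖ := by
  rw [← norm_pow, csqrt_sq]

theorem re_csqrt_pos {w : ℂ} (hw : w ∈ Complex.slitPlane) : 0 < (csqrt w).re := by
  rw [csqrt, Complex.cpow_inv_two_re, Real.sqrt_pos]
  have h1 := Complex.abs_re_le_norm w
  rcases hw with h | h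
  · positivity
  · have h2 := Complex.abs_re_lt_norm.2 h
    linarith [neg_abs_le w.re]

theorem csqrt_ne_zero {w : ℂ} (hw : w ≠ 0) : csqrt w ≠ 0 := by
  intro h
  apply hw
  rw [← csqrt_sq w, h]
  simp

theorem differentiableAt_csqrt {w : ℂ} (hw : w ∈ Complex.slitPlane) :
    DifferentiableAt ℂ csqrt w :=
  differentiableAt_id.cpow_const hw

/-- Differentiate `csqrt w ^ 2 = w`. -/
theorem hasDerivAt_csqrt {w : ℂ} (hw : w ∈ Complex.slitPlane) :
    HasDerivAt csqrt (2 * csqrt w)⁻¹ w := by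
  have h := (differentiableAt_csqrt hw).hasDerivAt
  have h0 := csqrt_ne_zero (Complex.slitPlane_ne_zero hw)
  have h2 : HasDerivAt (fun w : ℂ => w) (2 * csqrt w * deriv csqrt w) w := by
    simpa [csqrt_sq] using h.fun_pow 2
  have h3 := h2.unique (hasDerivAt_id w)
  rwa [← eq_inv_of_mul_eq_one_right h3]

theorem measurable_csqrt : Measurable csqrt := by
  unfold csqrt
  fun_prop

theorem sq_mem_slitPlane {z : ℂ} (hz : 0 < z.re) : z ^ 2 ∈ Complex.slitPlane := by
  rw [Complex.mem_slitPlane_iff]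
  by_cases h : z.im = 0
  · left
    simp only [pow_two, Complex.mul_re, h]
    nlinarith
  · right
    simp [pow_two, h, hz.ne', mul_comm z.im]

/-! ### The disk packing and the box mapping built from it. -/

/-- The right half of the annulus `1 / 2 < |z| < 1`. -/
def rightAnnulus : Set ℂ := {z | 0 < z.re ∧ 1 / 2 < ‖z‖ ∧ ‖z‖ < 1}

theorem isOpen_rightAnnulus : IsOpen rightAnnulus :=
  (isOpen_lt continuous_const Complex.continuous_re).inter
    ((isOpen_lt continuous_const continuous_norm).inter
      (isOpen_lt continuous_norm continuous_const))

/-- A packing of the right half annulus by disks of total area. -/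
structure DiskPacking where
  /-- the centers of the disks -/
  centers : Set ℂ
  /-- the radii of the disks -/
  radius : ℂ → ℝ
  countable : centers.Countable
  radius_pos : ∀ x ∈ centers, 0 < radius x
  closedBall_subset : ∀ x ∈ centers, Metric.closedBall x (radius x) ⊆ rightAnnulus
  -- Room for the round annulus with radii `2r` and `4r` about `x²`, which separates the tile from
  -- the unit circle.
  norm_sq_add_lt : ∀ x ∈ centers, ‖x‖ ^ 2 + 4 * radius x < 1
  pairwiseDisjoint : centers.PairwiseDisjoint fun x => Metric.closedBall x (radius x)
  volume_diff : volume (rightAnnulus \ ⋃ x ∈ centers, Metric.closedBall x (radius x)) = 0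

/-- The Besicovitch covering theorem applies because both constraints on a disk hold for all small
radii. -/
theorem exists_diskPacking : Nonempty DiskPacking := by
  obtain ⟨t, r, hc, hs, hr, hv, hd⟩ := Besicovitch.exists_disjoint_closedBall_covering_ae
    (volume : Measure ℂ)
    (fun x => {a | Metric.closedBall x a ⊆ rightAnnulus ∧ ‖x‖ ^ 2 + 4 * a < 1}) rightAnnulus
    (by
      intro x hx δ hδ
      obtain ⟨ε, hε, hball⟩ := Metric.isOpen_iff.1 isOpen_rightAnnulus x hx
      have h1 : 0 < (1 - ‖x‖ ^ 2) / 8 := by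
        have := norm_nonneg x
        have := hx.2.2
        nlinarith
      have h2 : 0 < min (min (ε / 2) (δ / 2)) ((1 - ‖x‖ ^ 2) / 8) := by positivity
      refine ⟨min (min (ε / 2) (δ / 2)) ((1 - ‖x‖ ^ 2) / 8), ⟨?_, ?_⟩, h2, ?_⟩
      · refine (Metric.closedBall_subset_ball ?_).trans hball
        exact ((min_le_left _ _).trans (min_le_left _ _)).trans_lt (half_lt_self hε)
      · have := min_le_right (min (ε / 2) (δ / 2)) ((1 - ‖x‖ ^ 2) / 8)
        linarith
      · exact ((min_le_left _ _).trans (min_le_right _ _)).trans_lt (half_lt_self hδ))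
    (fun _ => 1) (fun _ _ => one_pos)
  exact ⟨⟨t, r, hc, fun x hx => (hr x hx).2.1, fun x hx => (hr x hx).1.1,
    fun x hx => (hr x hx).1.2, hd, hv⟩⟩

namespace DiskPacking

variable (P : DiskPacking)

/-- The image of a disk of the packing under squaring. -/
def tile (x : ℂ) : Set ℂ := (fun z => z ^ 2) '' Metric.ball x (P.radius x)

/-- The closure of a tile. -/
def closedTile (x : ℂ) : Set ℂ := (fun z => z ^ 2) '' Metric.closedBall x (P.radius x)

/-- The components of the domain of the Lattès box mapping. -/
def pieces : Set (Set ℂ) := {Metric.ball 3 1, Metric.ball 0 (1 / 4)} ∪ P.tile '' P.centers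

/-- The components of the domain which are contained in the unit disk. -/
def innerPieces : Set (Set ℂ) := {Metric.ball 0 (1 / 4)} ∪ P.tile '' P.centers

/-- The domain of the Lattès box mapping. -/
def domain : Set ℂ := ⋃₀ P.pieces

open Classical in
/-- The center of the disk of the packing which contains the square root of a point. -/
noncomputable def centerOf (w : ℂ) : ℂ :=
  if h : ∃ x ∈ P.centers, csqrt w ∈ Metric.ball x (P.radius x) then h.choose else 0

open Classical in
/-- The Lattès box mapping. -/
noncomputable def map (w : ℂ) : ℂ :=
  if w ∈ Metric.ball (3 : ℂ) 1 then (w - 3) ^ 2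
  else if w ∈ Metric.ball (0 : ℂ) (1 / 4) then 4 * w
  -- In the coordinate `√w`, the affine map of the packed disk onto `ball 3 1`; off the tiles the
  -- value is irrelevant.
  else 3 + (csqrt w - P.centerOf w) / P.radius (P.centerOf w)

variable {P} {x : ℂ}

theorem re_pos_of_mem_closedBall (hx : x ∈ P.centers) {z : ℂ}
    (hz : z ∈ Metric.closedBall x (P.radius x)) : 0 < z.re := (P.closedBall_subset x hx hz).1

theorem closedTile_subset_slitPlane (hx : x ∈ P.centers) :
    P.closedTile x ⊆ Complex.slitPlane := by
  rintro _ ⟨z, hz, rfl⟩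
  exact sq_mem_slitPlane (re_pos_of_mem_closedBall hx hz)

theorem tile_subset_closedTile : P.tile x ⊆ P.closedTile x :=
  image_mono Metric.ball_subset_closedBall

theorem closure_tile (hx : x ∈ P.centers) : closure (P.tile x) = P.closedTile x :=
  closure_image_ball (P.radius_pos x hx) (by fun_prop)

theorem csqrt_mem_closedBall (hx : x ∈ P.centers) {w : ℂ} (hw : w ∈ P.closedTile x) :
    csqrt w ∈ Metric.closedBall x (P.radius x) := by
  obtain ⟨z, hz, rfl⟩ := hw
  simpa only [csqrt_of_sq (re_pos_of_mem_closedBall hx hz)] using hz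

theorem csqrt_mem_ball (hx : x ∈ P.centers) {w : ℂ} (hw : w ∈ P.tile x) :
    csqrt w ∈ Metric.ball x (P.radius x) := by
  obtain ⟨z, hz, rfl⟩ := hw
  simpa only [csqrt_of_sq (re_pos_of_mem_closedBall hx (Metric.ball_subset_closedBall hz))] using hz

theorem mem_tile_of_csqrt_mem {w : ℂ} (hw : csqrt w ∈ Metric.ball x (P.radius x)) :
    w ∈ P.tile x := ⟨csqrt w, hw, csqrt_sq w⟩

theorem isOpen_tile (hx : x ∈ P.centers) : IsOpen (P.tile x) := by
  have : P.tile x = Complex.slitPlane ∩ csqrt ⁻¹' Metric.ball x (P.radius x) := by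
    ext w
    exact ⟨fun hw => ⟨closedTile_subset_slitPlane hx (tile_subset_closedTile hw),
      csqrt_mem_ball hx hw⟩, fun hw => mem_tile_of_csqrt_mem hw.2⟩
  rw [this]
  refine ContinuousOn.isOpen_inter_preimage (fun w hw => ?_) Complex.isOpen_slitPlane
    Metric.isOpen_ball
  exact (differentiableAt_csqrt hw).continuousAt.continuousWithinAt

theorem isJordanDisk_tile (hx : x ∈ P.centers) : IsJordanDisk (P.tile x) := by
  refine isJordanDisk_image_ball (P.radius_pos x hx) (by fun_prop) ?_ (isOpen_tile hx)
  intro z hz y hy hzy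
  rw [← csqrt_of_sq (re_pos_of_mem_closedBall hx hz), ← csqrt_of_sq (re_pos_of_mem_closedBall hx hy)]
  exact congrArg csqrt hzy

theorem norm_of_mem_closedTile (hx : x ∈ P.centers) {w : ℂ} (hw : w ∈ P.closedTile x) :
    1 / 4 < ‖w‖ ∧ ‖w‖ < 1 := by
  obtain ⟨z, hz, rfl⟩ := hw
  obtain ⟨-, h1, h2⟩ := P.closedBall_subset x hx hz
  simp only [norm_pow]
  constructor <;> nlinarith

theorem disjoint_closedTile {y : ℂ} (hx : x ∈ P.centers) (hy : y ∈ P.centers) (hxy : x ≠ y) :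
    Disjoint (P.closedTile x) (P.closedTile y) := by
  rw [Set.disjoint_left]
  intro w hw hw'
  exact Set.disjoint_left.1 (P.pairwiseDisjoint hx hy hxy) (csqrt_mem_closedBall hx hw)
    (csqrt_mem_closedBall hy hw')

theorem not_mem_ball_three {w : ℂ} (hw : ‖w‖ < 2) : w ∉ Metric.ball (3 : ℂ) 1 := by
  intro h
  rw [mem_ball_iff_norm] at h
  have h1 := norm_sub_norm_le (3 : ℂ) w
  rw [norm_sub_rev] at h1
  have h3 : ‖(3 : ℂ)‖ = 3 := by simp
  linarith

theorem centerOf_eq (hx : x ∈ P.centers) {w : ℂ} (hw : w ∈ P.tile x) : P.centerOf w = x := by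
  have h : ∃ x ∈ P.centers, csqrt w ∈ Metric.ball x (P.radius x) := ⟨x, hx, csqrt_mem_ball hx hw⟩
  rw [centerOf, dif_pos h]
  by_contra hne
  exact Set.disjoint_left.1 (P.pairwiseDisjoint h.choose_spec.1 hx hne)
    (Metric.ball_subset_closedBall h.choose_spec.2)
    (Metric.ball_subset_closedBall (csqrt_mem_ball hx hw))

theorem map_of_mem_ball_three {w : ℂ} (hw : w ∈ Metric.ball (3 : ℂ) 1) :
    P.map w = (w - 3) ^ 2 := if_pos hw

theorem map_of_mem_ball_zero {w : ℂ} (hw : w ∈ Metric.ball (0 : ℂ) (1 / 4)) :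
    P.map w = 4 * w := by
  have : ‖w‖ < 2 := by
    rw [mem_ball_zero_iff] at hw
    linarith
  rw [map, if_neg (not_mem_ball_three this), if_pos hw]

theorem map_of_mem_tile (hx : x ∈ P.centers) {w : ℂ} (hw : w ∈ P.tile x) :
    P.map w = 3 + (csqrt w - x) / P.radius x := by
  have h := norm_of_mem_closedTile hx (tile_subset_closedTile hw)
  have h1 : w ∉ Metric.ball (0 : ℂ) (1 / 4) := by
    rw [mem_ball_zero_iff]
    exact h.1.not_gt
  rw [map, if_neg (not_mem_ball_three (by linarith)), if_neg h1, centerOf_eq hx hw]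

theorem hasDerivAt_map_of_mem_ball_three {w : ℂ} (hw : w ∈ Metric.ball (3 : ℂ) 1) :
    HasDerivAt P.map (2 * (w - 3)) w := by
  have h : HasDerivAt (fun w : ℂ => (w - 3) ^ 2) (2 * (w - 3)) w := by
    simpa using ((hasDerivAt_id w).sub_const 3).fun_pow 2
  refine h.congr_of_eventuallyEq ?_
  filter_upwards [Metric.isOpen_ball.mem_nhds hw] with z hz using map_of_mem_ball_three hz

theorem hasDerivAt_map_of_mem_ball_zero {w : ℂ} (hw : w ∈ Metric.ball (0 : ℂ) (1 / 4)) :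
    HasDerivAt P.map 4 w := by
  have h : HasDerivAt (fun w : ℂ => 4 * w) 4 w := by
    simpa using (hasDerivAt_id w).const_mul 4
  refine h.congr_of_eventuallyEq ?_
  filter_upwards [Metric.isOpen_ball.mem_nhds hw] with z hz using map_of_mem_ball_zero hz

theorem hasDerivAt_map_of_mem_tile (hx : x ∈ P.centers) {w : ℂ} (hw : w ∈ P.tile x) :
    HasDerivAt P.map ((2 * csqrt w)⁻¹ / P.radius x) w := by
  have h : HasDerivAt (fun w : ℂ => 3 + (csqrt w - x) / P.radius x)
      ((2 * csqrt w)⁻¹ / P.radius x) w :=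
    (((hasDerivAt_csqrt (closedTile_subset_slitPlane hx (tile_subset_closedTile hw))).sub_const
      x).div_const _).const_add 3
  refine h.congr_of_eventuallyEq ?_
  filter_upwards [(isOpen_tile hx).mem_nhds hw] with z hz using map_of_mem_tile hx hz

theorem image_map_ball_three : P.map '' Metric.ball 3 1 = Metric.ball 0 1 := by
  ext w
  constructor
  · rintro ⟨z, hz, rfl⟩
    rw [map_of_mem_ball_three hz, mem_ball_zero_iff, norm_pow]
    rw [mem_ball_iff_norm] at hz
    nlinarith [norm_nonneg (z - 3)]
  · intro hw
    have h : 3 + csqrt w ∈ Metric.ball (3 : ℂ) 1 := by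
      rw [mem_ball_iff_norm, add_sub_cancel_left]
      rw [mem_ball_zero_iff, ← norm_csqrt_sq] at hw
      nlinarith
    exact ⟨_, h, by rw [map_of_mem_ball_three h, add_sub_cancel_left, csqrt_sq]⟩

theorem image_map_ball_zero : P.map '' Metric.ball 0 (1 / 4) = Metric.ball 0 1 := by
  ext w
  constructor
  · rintro ⟨z, hz, rfl⟩
    rw [map_of_mem_ball_zero hz, mem_ball_zero_iff, norm_mul]
    rw [mem_ball_zero_iff] at hz
    norm_num
    linarith
  · intro hw
    have h : w / 4 ∈ Metric.ball (0 : ℂ) (1 / 4) := by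
      rw [mem_ball_zero_iff] at hw ⊢
      rw [norm_div]
      norm_num
      linarith
    exact ⟨_, h, by rw [map_of_mem_ball_zero h]; ring⟩

theorem image_map_tile (hx : x ∈ P.centers) : P.map '' P.tile x = Metric.ball 3 1 := by
  have hr := P.radius_pos x hx
  have hr' : (P.radius x : ℂ) ≠ 0 := by exact_mod_cast hr.ne'
  ext w
  constructor
  · rintro ⟨z, hz, rfl⟩
    have h := csqrt_mem_ball hx hz
    rw [mem_ball_iff_norm] at h
    rw [map_of_mem_tile hx hz, mem_ball_iff_norm, add_sub_cancel_left, norm_div, Complex.norm_real,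
      Real.norm_of_nonneg hr.le, div_lt_one hr]
    exact h
  · intro hw
    have h : x + P.radius x * (w - 3) ∈ Metric.ball x (P.radius x) := by
      rw [mem_ball_iff_norm] at hw ⊢
      rw [add_sub_cancel_left, norm_mul, Complex.norm_real, Real.norm_of_nonneg hr.le]
      nlinarith
    refine ⟨_, ⟨_, h, rfl⟩, ?_⟩
    rw [map_of_mem_tile hx ⟨_, h, rfl⟩]
    simp only
    rw [csqrt_of_sq (re_pos_of_mem_closedBall hx (Metric.ball_subset_closedBall h))]
    field_simp
    ring

/-- The map is two-to-one here, so there is no inverse to use. Instead, a compact `k` in the open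
unit disk has the same preimage in the closed ball as in the open one. -/
theorem isProperMap_ball_three : IsProperMap ((mapsTo_image P.map (Metric.ball 3 1)).restrict
    P.map (Metric.ball 3 1) (P.map '' Metric.ball 3 1)) := by
  refine isProperMap_restrict_image
    (fun w hw => (hasDerivAt_map_of_mem_ball_three hw).continuousAt.continuousWithinAt) ?_
  rw [image_map_ball_three]
  intro k hk hc
  have : Metric.ball 3 1 ∩ P.map ⁻¹' k = Metric.closedBall 3 1 ∩ (fun w => (w - 3) ^ 2) ⁻¹' k := by
    ext w
    constructor
    · rintro ⟨hw, hwk⟩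
      refine ⟨Metric.ball_subset_closedBall hw, ?_⟩
      rwa [mem_preimage, map_of_mem_ball_three hw] at hwk
    · rintro ⟨-, hwk⟩
      have hw : w ∈ Metric.ball (3 : ℂ) 1 := by
        have := hk hwk
        rw [mem_ball_zero_iff, norm_pow] at this
        rw [mem_ball_iff_norm]
        nlinarith
      refine ⟨hw, ?_⟩
      rwa [mem_preimage, map_of_mem_ball_three hw]
  rw [this]
  exact (isCompact_closedBall _ _).inter_right (hc.isClosed.preimage (by fun_prop))

theorem isProperMap_ball_zero : IsProperMap ((mapsTo_image P.map (Metric.ball 0 (1 / 4))).restrict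
    P.map (Metric.ball 0 (1 / 4)) (P.map '' Metric.ball 0 (1 / 4))) := by
  refine isProperMap_restrict_of_leftInvOn (g := fun w => w / 4)
    (fun w hw => (hasDerivAt_map_of_mem_ball_zero hw).continuousAt.continuousWithinAt)
    (by fun_prop) fun w hw => ?_
  simp only [map_of_mem_ball_zero hw]
  ring

theorem isProperMap_tile (hx : x ∈ P.centers) :
    IsProperMap ((mapsTo_image P.map (P.tile x)).restrict
      P.map (P.tile x) (P.map '' P.tile x)) := by
  refine isProperMap_restrict_of_leftInvOn (g := fun w => (x + P.radius x * (w - 3)) ^ 2)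
    (fun w hw => (hasDerivAt_map_of_mem_tile hx hw).continuousAt.continuousWithinAt)
    (by fun_prop) fun w hw => ?_
  have hr' : (P.radius x : ℂ) ≠ 0 := by exact_mod_cast (P.radius_pos x hx).ne'
  simp only [map_of_mem_tile hx hw]
  rw [add_sub_cancel_left, mul_div_cancel₀ _ hr', add_sub_cancel, csqrt_sq]

theorem mem_domain_iff {w : ℂ} : w ∈ P.domain ↔ w ∈ Metric.ball (3 : ℂ) 1 ∨
    w ∈ Metric.ball (0 : ℂ) (1 / 4) ∨ ∃ x ∈ P.centers, w ∈ P.tile x := by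
  simp only [domain, pieces, mem_sUnion, mem_union, mem_insert_iff, mem_singleton_iff, mem_image]
  constructor
  · rintro ⟨t, ((rfl | rfl) | ⟨x, hx, rfl⟩), hw⟩
    · exact Or.inl hw
    · exact Or.inr (Or.inl hw)
    · exact Or.inr (Or.inr ⟨x, hx, hw⟩)
  · rintro (hw | hw | ⟨x, hx, hw⟩)
    · exact ⟨_, Or.inl (Or.inl rfl), hw⟩
    · exact ⟨_, Or.inl (Or.inr rfl), hw⟩
    · exact ⟨_, Or.inr ⟨x, hx, rfl⟩, hw⟩

theorem isJordanDisk_of_mem_innerPieces {B : Set ℂ} (hB : B ∈ P.innerPieces) :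
    IsJordanDisk B ∧ closure B ⊆ Metric.ball 0 1 := by
  rcases hB with rfl | ⟨x, hx, rfl⟩
  · refine ⟨isJordanDisk_ball (by norm_num), ?_⟩
    rw [closure_ball _ (by norm_num)]
    exact Metric.closedBall_subset_ball (by norm_num)
  · refine ⟨isJordanDisk_tile hx, ?_⟩
    rw [closure_tile hx]
    exact fun w hw => mem_ball_zero_iff.2 (norm_of_mem_closedTile hx hw).2

theorem pairwiseDisjoint_innerPieces : P.innerPieces.PairwiseDisjoint closure := by
  have h0 : ∀ x ∈ P.centers, Disjoint (closure (Metric.ball (0 : ℂ) (1 / 4)))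
      (closure (P.tile x)) := by
    intro x hx
    rw [closure_tile hx, closure_ball _ (by norm_num), Set.disjoint_left]
    intro w hw hw'
    rw [mem_closedBall_zero_iff] at hw
    exact (norm_of_mem_closedTile hx hw').1.not_ge hw
  rintro A (rfl | ⟨x, hx, rfl⟩) B (rfl | ⟨y, hy, rfl⟩) hAB
  · exact absurd rfl hAB
  · exact h0 y hy
  · exact (h0 x hx).symm
  · simp only [Function.onFun, closure_tile hx, closure_tile hy]
    exact disjoint_closedTile hx hy fun h => hAB (h ▸ rfl)

theorem pieces_eq : P.pieces = insert (Metric.ball 3 1) P.innerPieces := by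
  rw [pieces, innerPieces, insert_union, singleton_union]

theorem disjoint_closedBall_three_ball_zero :
    Disjoint (Metric.closedBall (3 : ℂ) 1) (Metric.closedBall 0 1) := by
  apply Metric.closedBall_disjoint_closedBall
  norm_num

theorem disjoint_ball_three_of_mem_innerPieces {B : Set ℂ} (hB : B ∈ P.innerPieces) :
    Disjoint (Metric.ball 3 1) B :=
  disjoint_closedBall_three_ball_zero.mono Metric.ball_subset_closedBall
    ((subset_closure.trans (isJordanDisk_of_mem_innerPieces hB).2).trans
      Metric.ball_subset_closedBall)

theorem components_domain : components P.domain = P.pieces := by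
  have hJ : ∀ A ∈ P.pieces, IsJordanDisk A := by
    rw [pieces_eq]
    rintro A (rfl | hA)
    · exact isJordanDisk_ball one_pos
    · exact (isJordanDisk_of_mem_innerPieces hA).1
  refine components_sUnion (fun A hA => (hJ A hA).1)
    (fun A hA => (hJ A hA).2.1.isPathConnected.isConnected) ?_
  rw [pieces_eq]
  refine (pairwiseDisjoint_insert.2 ⟨fun A hA B hB hAB => ?_, fun B hB _ => ?_⟩)
  · exact (pairwiseDisjoint_innerPieces hA hB hAB).mono subset_closure subset_closure
  · exact disjoint_ball_three_of_mem_innerPieces hB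

theorem sUnion_innerPieces_subset : ⋃₀ P.innerPieces ⊆ Metric.ball 0 1 :=
  sUnion_subset fun _ hB => subset_closure.trans (isJordanDisk_of_mem_innerPieces hB).2

theorem domain_eq : P.domain = Metric.ball 3 1 ∪ ⋃₀ P.innerPieces := by
  rw [domain, pieces_eq, sUnion_insert]

theorem domain_inter_ball_zero : P.domain ∩ Metric.ball 0 1 = ⋃₀ P.innerPieces := by
  rw [domain_eq, union_inter_distrib_right, inter_eq_left.2 sUnion_innerPieces_subset,
    (disjoint_closedBall_three_ball_zero.mono Metric.ball_subset_closedBall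
      Metric.ball_subset_closedBall).inter_eq, empty_union]

theorem components_domain_inter_ball_zero :
    components (P.domain ∩ Metric.ball 0 1) = P.innerPieces := by
  rw [domain_inter_ball_zero]
  refine components_sUnion (fun A hA => (isJordanDisk_of_mem_innerPieces hA).1.1)
    (fun A hA => (isJordanDisk_of_mem_innerPieces hA).1.2.1.isPathConnected.isConnected)
    fun A hA B hB hAB => ?_
  exact (pairwiseDisjoint_innerPieces hA hB hAB).mono subset_closure subset_closure

theorem components_range :
    components (Metric.ball (3 : ℂ) 1 ∪ Metric.ball 0 1) =
      {Metric.ball 3 1, Metric.ball 0 1} := by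
  rw [← sUnion_pair]
  refine components_sUnion ?_ ?_ ?_
  · rintro A (rfl | rfl) <;> exact Metric.isOpen_ball
  · rintro A (rfl | rfl) <;>
      exact (isJordanDisk_ball one_pos).2.1.isPathConnected.isConnected
  · have := disjoint_closedBall_three_ball_zero.mono Metric.ball_subset_closedBall
      Metric.ball_subset_closedBall
    rintro A (rfl | rfl) B (rfl | rfl) hAB
    · exact absurd rfl hAB
    · exact this
    · exact this.symm
    · exact absurd rfl hAB

theorem image_map_mem_components {B : Set ℂ} (hB : B ∈ P.pieces) :
    P.map '' B ∈ components (Metric.ball (3 : ℂ) 1 ∪ Metric.ball 0 1) := by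
  rw [components_range]
  rcases hB with (rfl | rfl) | ⟨x, hx, rfl⟩
  · rw [image_map_ball_three]
    exact Or.inr rfl
  · rw [image_map_ball_zero]
    exact Or.inr rfl
  · rw [image_map_tile hx]
    exact Or.inl rfl

theorem crit_eq : {w ∈ P.domain | deriv P.map w = 0} = {3} := by
  ext w
  constructor
  · rintro ⟨hw, h⟩
    rw [mem_domain_iff] at hw
    rcases hw with hw | hw | ⟨x, hx, hw⟩
    · rw [(hasDerivAt_map_of_mem_ball_three hw).deriv] at h
      simpa [sub_eq_zero] using h
    · rw [(hasDerivAt_map_of_mem_ball_zero hw).deriv] at h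
      norm_num at h
    · rw [(hasDerivAt_map_of_mem_tile hx hw).deriv] at h
      have h0 := csqrt_ne_zero (Complex.slitPlane_ne_zero
        (closedTile_subset_slitPlane hx (tile_subset_closedTile hw)))
      have hr' : (P.radius x : ℂ) ≠ 0 := by exact_mod_cast (P.radius_pos x hx).ne'
      simp [h0, hr'] at h
  · rintro rfl
    have h : (3 : ℂ) ∈ Metric.ball (3 : ℂ) 1 := Metric.mem_ball_self one_pos
    exact ⟨mem_domain_iff.2 (Or.inl h), by simp [(hasDerivAt_map_of_mem_ball_three h).deriv]⟩

variable (P)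

/-- The Lattès box mapping of a disk packing. -/
noncomputable def boxMapping : ComplexBoxMapping where
  U := P.domain
  V := Metric.ball 3 1 ∪ Metric.ball 0 1
  f := P.map
  isOpen_U := by
    rw [domain_eq]
    exact Metric.isOpen_ball.union
      (isOpen_sUnion fun B hB => (isJordanDisk_of_mem_innerPieces hB).1.1)
  isOpen_V := Metric.isOpen_ball.union Metric.isOpen_ball
  U_subset_V := by
    rw [domain_eq]
    exact union_subset_union_right _ sUnion_innerPieces_subset
  mapsTo := by
    rintro w ⟨B, hB, hw⟩
    obtain ⟨y, hy, h⟩ := image_map_mem_components hB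
    exact connectedComponentIn_subset _ _ (h ▸ mem_image_of_mem P.map hw)
  holomorphic := by
    intro w hw
    rcases mem_domain_iff.1 hw with hw | hw | ⟨x, hx, hw⟩
    · exact (hasDerivAt_map_of_mem_ball_three hw).differentiableAt.differentiableWithinAt
    · exact (hasDerivAt_map_of_mem_ball_zero hw).differentiableAt.differentiableWithinAt
    · exact (hasDerivAt_map_of_mem_tile hx hw).differentiableAt.differentiableWithinAt
  finite_crit := by
    rw [crit_eq]
    exact finite_singleton 3
  V_eq := by
    refine ⟨{Metric.ball 3 1, Metric.ball 0 1}, by simp, ?_, ?_, by rw [sUnion_pair]⟩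
    · rintro A (rfl | rfl) <;> exact isJordanDisk_ball one_pos
    · have : Disjoint (closure (Metric.ball (3 : ℂ) 1)) (closure (Metric.ball 0 1)) := by
        rw [closure_ball _ one_ne_zero, closure_ball _ one_ne_zero]
        exact disjoint_closedBall_three_ball_zero
      rintro A (rfl | rfl) B (rfl | rfl) hAB
      · exact absurd rfl hAB
      · exact this
      · exact this.symm
      · exact absurd rfl hAB
  U_inter := by
    rw [components_range, components_domain]
    rintro A (rfl | rfl)
    · exact Or.inl (Or.inl (Or.inl rfl))
    · refine Or.inr ⟨P.innerPieces, fun B hB => isJordanDisk_of_mem_innerPieces hB,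
        pairwiseDisjoint_innerPieces, ?_⟩
      rw [inter_comm, domain_inter_ball_zero]
  image_mem := by
    rw [components_domain]
    exact fun B hB => image_map_mem_components hB
  isProperMap := by
    rw [components_domain]
    rintro B ((rfl | rfl) | ⟨x, hx, rfl⟩)
    · exact isProperMap_ball_three
    · exact isProperMap_ball_zero
    · exact isProperMap_tile hx

end DiskPacking

end Lattes

/-! ### Null sets: the tiling and the inverse branches. -/

namespace Lattes

theorem volume_re_eq_zero : volume {w : ℂ | w.re = 0} = 0 := by
  have h := Measure.addHaar_submodule (volume : Measure ℂ) (LinearMap.ker Complex.reLm) (by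
    intro h
    have : (1 : ℂ) ∈ LinearMap.ker Complex.reLm := h ▸ Submodule.mem_top
    simp at this)
  exact h

theorem volume_im_eq_zero : volume {w : ℂ | w.im = 0} = 0 := by
  have h := Measure.addHaar_submodule (volume : Measure ℂ) (LinearMap.ker Complex.imLm) (by
    intro h
    have : Complex.I ∈ LinearMap.ker Complex.imLm := h ▸ Submodule.mem_top
    simp at this)
  exact h

theorem volume_image_eq_zero {g : ℂ → ℂ} {N : Set ℂ} (hg : DifferentiableOn ℂ g N)
    (hN : volume N = 0) : volume (g '' N) = 0 :=
  addHaar_image_eq_zero_of_differentiableOn_of_addHaar_eq_zero volume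
    (hg.restrictScalars ℝ) hN

theorem mem_slitPlane_of_im_ne_zero {w : ℂ} (hw : w ∉ {w : ℂ | w.im = 0}) :
    w ∈ Complex.slitPlane := Or.inr hw

/-- Off the imaginary axis, the preimage is covered by the two differentiable branches `±csqrt`. -/
theorem volume_preimage_sq_eq_zero {N : Set ℂ} (hN : volume N = 0) :
    volume ((fun z : ℂ => z ^ 2) ⁻¹' N) = 0 := by
  have h1 : volume (csqrt '' (N ∩ Complex.slitPlane)) = 0 :=
    volume_image_eq_zero (fun w hw => (differentiableAt_csqrt hw.2).differentiableWithinAt)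
      (measure_mono_null inter_subset_left hN)
  have h2 := volume_image_eq_zero (g := fun z => -z) (by fun_prop) h1
  refine measure_mono_null ?_ (measure_union_null (measure_union_null h1 h2) volume_re_eq_zero)
  intro z hz
  rcases lt_trichotomy z.re 0 with h | h | h
  · have h' : 0 < (-z).re := by simpa using h
    refine Or.inl (Or.inr ⟨-z, ⟨z ^ 2, ⟨hz, ?_⟩, ?_⟩, neg_neg z⟩)
    · rw [← neg_sq]
      exact sq_mem_slitPlane h'
    · rw [← neg_sq]
      exact csqrt_of_sq h'
  · exact Or.inr h
  · exact Or.inl (Or.inl ⟨z ^ 2, ⟨hz, sq_mem_slitPlane h⟩, csqrt_of_sq h⟩)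

namespace DiskPacking

variable {P : DiskPacking} {x : ℂ}

theorem volume_rightAnnulus_diff_balls :
    volume (rightAnnulus \ ⋃ x ∈ P.centers, Metric.ball x (P.radius x)) = 0 := by
  have h : volume (⋃ x ∈ P.centers, Metric.sphere x (P.radius x)) = 0 := by
    rw [measure_biUnion_null_iff P.countable]
    exact fun x hx => Measure.addHaar_sphere_of_ne_zero _ _ (P.radius_pos x hx).ne'
  refine measure_mono_null ?_ (measure_union_null P.volume_diff h)
  rintro z ⟨hz, hz'⟩
  by_cases h1 : z ∈ ⋃ x ∈ P.centers, Metric.closedBall x (P.radius x)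
  · right
    simp only [mem_iUnion, exists_prop] at h1 hz' ⊢
    obtain ⟨x, hx, hzx⟩ := h1
    refine ⟨x, hx, ?_⟩
    rw [← Metric.closedBall_sdiff_ball]
    exact ⟨hzx, fun h => hz' ⟨x, hx, h⟩⟩
  · exact Or.inl ⟨hz, h1⟩

/-- Off the real axis and the circle of radius `1/4`, a point outside the central disk has its root
in the half annulus. The part missed by the tiles is thus the square of the null remainder of the
packing. -/
theorem volume_ball_diff_domain : volume (Metric.ball 0 1 \ P.domain) = 0 := by
  have h1 := volume_image_eq_zero (g := fun z => z ^ 2) (by fun_prop)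
    (volume_rightAnnulus_diff_balls (P := P))
  have h2 : volume (Metric.sphere (0 : ℂ) (1 / 4)) = 0 :=
    Measure.addHaar_sphere_of_ne_zero _ _ (by norm_num)
  refine measure_mono_null ?_ (measure_union_null (measure_union_null h1 h2) volume_im_eq_zero)
  rintro w ⟨hw, hw'⟩
  by_cases him : w ∈ {w : ℂ | w.im = 0}
  · exact Or.inr him
  left
  by_cases hs : w ∈ Metric.sphere (0 : ℂ) (1 / 4)
  · exact Or.inr hs
  left
  rw [mem_domain_iff] at hw'
  push Not at hw'
  obtain ⟨-, h0, ht⟩ := hw'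
  rw [mem_ball_zero_iff] at hw h0
  rw [mem_sphere_zero_iff_norm] at hs
  have hw4 : 1 / 4 < ‖w‖ := lt_of_le_of_ne (not_lt.1 h0) (Ne.symm hs)
  refine ⟨csqrt w, ⟨⟨re_csqrt_pos (mem_slitPlane_of_im_ne_zero him), ?_, ?_⟩, ?_⟩, csqrt_sq w⟩
  · rw [← norm_csqrt_sq] at hw4
    nlinarith [norm_nonneg (csqrt w)]
  · rw [← norm_csqrt_sq] at hw
    nlinarith [norm_nonneg (csqrt w)]
  · simp only [mem_iUnion, exists_prop, not_exists, not_and]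
    exact fun x hx h => ht x hx (mem_tile_of_csqrt_mem h)

theorem volume_range_diff_domain :
    volume (P.boxMapping.V \ P.boxMapping.U) = 0 := by
  refine measure_mono_null ?_ (volume_ball_diff_domain (P := P))
  rintro w ⟨hw | hw, hw'⟩
  · exact absurd (mem_domain_iff.2 (Or.inl hw)) hw'
  · exact ⟨hw, hw'⟩

/-- Countably many differentiable inverse branches on the tiles and central disk, and the squaring
lemma on `ball 3 1`. -/
theorem volume_domain_inter_preimage {N : Set ℂ} (hN : volume N = 0) :
    volume (P.domain ∩ P.map ⁻¹' N) = 0 := by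
  have h1 := volume_image_eq_zero (g := fun z => 3 + z) (by fun_prop)
    (volume_preimage_sq_eq_zero hN)
  have h2 := volume_image_eq_zero (g := fun z => z / 4) (by fun_prop) hN
  have h3 : volume (⋃ x ∈ P.centers, (fun z => (x + P.radius x * (z - 3)) ^ 2) '' N) = 0 := by
    rw [measure_biUnion_null_iff P.countable]
    exact fun x _ => volume_image_eq_zero (by fun_prop) hN
  refine measure_mono_null ?_ (measure_union_null (measure_union_null h1 h2) h3)
  rintro w ⟨hw, hwN⟩
  rw [mem_preimage] at hwN
  rcases mem_domain_iff.1 hw with hw | hw | ⟨x, hx, hw⟩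
  · rw [map_of_mem_ball_three hw] at hwN
    exact Or.inl (Or.inl ⟨w - 3, hwN, by simp⟩)
  · rw [map_of_mem_ball_zero hw] at hwN
    exact Or.inl (Or.inr ⟨_, hwN, by ring⟩)
  · rw [map_of_mem_tile hx hw] at hwN
    right
    simp only [mem_iUnion, exists_prop]
    refine ⟨x, hx, _, hwN, ?_⟩
    have hr' : (P.radius x : ℂ) ≠ 0 := by exact_mod_cast (P.radius_pos x hx).ne'
    simp only
    rw [add_sub_cancel_left, mul_div_cancel₀ _ hr', add_sub_cancel, csqrt_sq]

end DiskPacking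
end Lattes

/-! ### Non-escaping points and null sets for general box mappings. -/

namespace ComplexBoxMapping

variable {F : ComplexBoxMapping}

theorem isOpen_preimageV (n : ℕ) : IsOpen (F.preimageV n) := by
  induction n with
  | zero => exact F.isOpen_V
  | succ n ih => exact F.holomorphic.continuousOn.isOpen_inter_preimage F.isOpen_U ih

theorem preimageV_subset (n : ℕ) : F.preimageV n ⊆ F.V := by
  cases n with
  | zero => exact subset_rfl
  | succ n => exact inter_subset_left.trans F.U_subset_V

theorem preimageV_succ_subset (n : ℕ) : F.preimageV (n + 1) ⊆ F.preimageV n := by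
  induction n with
  | zero => exact preimageV_subset 1
  | succ n ih => exact inter_subset_inter_right _ (preimage_mono ih)

theorem K_subset_V : F.K ⊆ F.V := iInter_subset _ 0

theorem mem_K_iff {x : ℂ} : x ∈ F.K ↔ x ∈ F.U ∧ F.f x ∈ F.K := by
  simp only [K, mem_iInter]
  constructor
  · exact fun h => ⟨(h 1).1, fun n => (h (n + 1)).2⟩
  · rintro ⟨hx, h⟩ n
    exact preimageV_succ_subset n ⟨hx, h n⟩

theorem iterate_mem_K {x : ℂ} (hx : x ∈ F.K) (n : ℕ) : F.f^[n] x ∈ F.K := by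
  induction n with
  | zero => exact hx
  | succ n ih =>
    rw [Function.iterate_succ_apply']
    exact (mem_K_iff.1 ih).2

theorem IsPuzzleNeighborhood.isOpen {A W : Set ℂ} (h : F.IsPuzzleNeighborhood A W) :
    IsOpen W := by
  obtain ⟨⟨S, -, hS, rfl⟩, -, -⟩ := h
  refine isOpen_sUnion fun P hP => ?_
  obtain ⟨n, x, -, rfl⟩ := hS P hP
  exact (isOpen_preimageV n).connectedComponentIn

/-- Preimages of null sets in the domain are null. -/
def IsNonsingular (F : ComplexBoxMapping) : Prop :=
  ∀ N : Set ℂ, volume N = 0 → volume (F.U ∩ F.f ⁻¹' N) = 0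

/-- A point escaping at step `n + 1` either lies outside `U` or maps to a point escaping by step
`n`; the second set is null by nonsingularity. -/
theorem IsNonsingular.volume_V_diff_K (hF : F.IsNonsingular) (h : volume (F.V \ F.U) = 0) :
    volume (F.V \ F.K) = 0 := by
  have key : ∀ n, volume (F.V \ F.preimageV n) = 0 := by
    intro n
    induction n with
    | zero => simp [preimageV]
    | succ n ih =>
      refine measure_mono_null ?_ (measure_union_null h (hF _ ih))
      rintro w ⟨hw, hw'⟩
      by_cases hU : w ∈ F.U
      · exact Or.inr ⟨hU, F.mapsTo hU, fun h => hw' ⟨hU, h⟩⟩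
      · exact Or.inl ⟨hw, hU⟩
  rw [K, sdiff_iInter, measure_iUnion_null_iff]
  exact key

theorem IsNonsingular.volume_K_inter_iterate_preimage (hF : F.IsNonsingular) {N : Set ℂ}
    (hN : volume N = 0) : volume {x ∈ F.K | ∃ n : ℕ, F.f^[n] x ∈ N} = 0 := by
  have key : ∀ n : ℕ, volume {x ∈ F.K | F.f^[n] x ∈ N} = 0 := by
    intro n
    induction n with
    | zero => exact measure_mono_null (fun x hx => hx.2) hN
    | succ n ih =>
      refine measure_mono_null ?_ (hF _ ih)
      rintro x ⟨hx, hxN⟩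
      exact ⟨(mem_K_iff.1 hx).1, (mem_K_iff.1 hx).2, hxN⟩
  refine measure_mono_null ?_ (measure_iUnion_null key)
  rintro x ⟨hx, n, hn⟩
  exact mem_iUnion.2 ⟨n, hx, hn⟩

end ComplexBoxMapping

/-! ### Area of the filled Julia set and the invariant line field. -/

namespace Lattes

open ComplexBoxMapping

/-- A direction's square, up to a positive factor, determines the line. This removes the sign
ambiguity of the square root. -/
theorem span_singleton_eq_of_sq_eq {a b : ℂ} {k : ℝ} (hk : 0 < k) (h : a ^ 2 = k * b ^ 2) :
    Submodule.span ℝ {a} = Submodule.span ℝ {b} := by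
  have hs : ((√k : ℝ) : ℂ) ^ 2 = k := by
    rw [← Complex.ofReal_pow, Real.sq_sqrt hk.le]
  have h0 : IsUnit (√k) := (Real.sqrt_pos.2 hk).ne'.isUnit
  rw [← hs, ← mul_pow, sq_eq_sq_iff_eq_or_eq_neg] at h
  rcases h with rfl | rfl
  · rw [← Complex.real_smul, Submodule.span_singleton_smul_eq h0]
  · rw [← neg_mul, ← Complex.ofReal_neg, ← Complex.real_smul,
      Submodule.span_singleton_smul_eq h0.neg]

namespace DiskPacking

variable {P : DiskPacking} {x : ℂ}

theorem isNonsingular_boxMapping : P.boxMapping.IsNonsingular :=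
  fun _ hN => volume_domain_inter_preimage hN

theorem volume_V_diff_K : volume (P.boxMapping.V \ P.boxMapping.K) = 0 :=
  isNonsingular_boxMapping.volume_V_diff_K volume_range_diff_domain

theorem volume_V_pos : 0 < volume P.boxMapping.V :=
  P.boxMapping.isOpen_V.measure_pos volume ⟨3, Or.inl (Metric.mem_ball_self one_pos)⟩

theorem volume_K_pos : 0 < volume P.boxMapping.K := by
  refine (volume_V_pos (P := P)).trans_le ?_
  calc volume P.boxMapping.V ≤ volume (P.boxMapping.K ∪ P.boxMapping.V \ P.boxMapping.K) :=
        measure_mono fun w hw => (em (w ∈ P.boxMapping.K)).imp id fun h => ⟨hw, h⟩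
    _ ≤ volume P.boxMapping.K + volume (P.boxMapping.V \ P.boxMapping.K) := measure_union_le _ _
    _ = volume P.boxMapping.K := by rw [volume_V_diff_K, add_zero]

theorem map_three : P.map 3 = 0 := by
  rw [map_of_mem_ball_three (Metric.mem_ball_self one_pos)]
  simp

theorem map_zero : P.map 0 = 0 := by
  rw [map_of_mem_ball_zero (Metric.mem_ball_self (by norm_num))]
  simp

/-- The non-escaping points which are not eventually mapped to the fixed point `0`. -/
def lineFieldSupport (P : DiskPacking) : Set ℂ :=
  {w ∈ P.boxMapping.K | ∀ n : ℕ, P.map^[n] w ≠ 0}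

open Classical in
/-- The direction of the invariant line field. -/
noncomputable def direction (w : ℂ) : ℂ := if w ∈ Metric.ball (3 : ℂ) 1 then 1 else csqrt w

theorem measurable_direction : Measurable direction :=
  Measurable.ite Metric.isOpen_ball.measurableSet measurable_const measurable_csqrt

theorem direction_ne_zero {w : ℂ} (hw : w ≠ 0) : direction w ≠ 0 := by
  unfold direction
  split_ifs
  · exact one_ne_zero
  · exact csqrt_ne_zero hw

theorem volume_K_diff_lineFieldSupport :
    volume (P.boxMapping.K \ P.lineFieldSupport) = 0 := by
  refine measure_mono_null ?_ (isNonsingular_boxMapping.volume_K_inter_iterate_preimage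
    (F := P.boxMapping) (measure_singleton (0 : ℂ)))
  rintro w ⟨hw, hw'⟩
  refine ⟨hw, ?_⟩
  by_contra h
  push Not at h
  exact hw' ⟨hw, h⟩

/-- Gives null measurability and positive area of the support at once, since the range is open. -/
theorem lineFieldSupport_ae_eq : P.lineFieldSupport =ᵐ[volume] P.boxMapping.V := by
  have hsub : P.lineFieldSupport ⊆ P.boxMapping.V := fun w hw => K_subset_V hw.1
  refine hsub.eventuallyLE.antisymm ?_
  rw [ae_le_set]
  refine measure_mono_null ?_ (measure_union_null (volume_V_diff_K (P := P))
    (volume_K_diff_lineFieldSupport (P := P)))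
  rintro w ⟨hw, hw'⟩
  by_cases h : w ∈ P.boxMapping.K
  · exact Or.inr ⟨h, hw'⟩
  · exact Or.inl ⟨hw, h⟩

variable (P) in
/-- The invariant line field of the Lattès box mapping. -/
noncomputable def lineField : LineField P.boxMapping.K where
  E := P.lineFieldSupport
  E_subset := sep_subset _ _
  nullMeasurableSet_E :=
    P.boxMapping.isOpen_V.measurableSet.nullMeasurableSet.congr lineFieldSupport_ae_eq.symm
  volume_E_pos := by
    rw [measure_congr lineFieldSupport_ae_eq]
    exact volume_V_pos
  line w := Submodule.span ℝ {direction w}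
  finrank_line w hw := finrank_span_singleton (direction_ne_zero (hw.2 0))
  measurable_line := ⟨direction, measurable_direction.aemeasurable, fun _ _ => rfl⟩

/-- Compare squares: `(2(w - 3))² = 4 (w - 3)²` on `ball 3 1`, `4² w = 4 · (4w)` on the central
disk, and `((2√w)⁻¹ r⁻¹ √w)² = 1/(4r²)` on a tile of radius `r`. -/
theorem direction_map {w : ℂ} (hw : w ∈ P.domain) (h0 : w ≠ 0) :
    DifferentiableAt ℂ P.map w ∧ Submodule.span ℝ {deriv P.map w * direction w} =
      Submodule.span ℝ {direction (P.map w)} := by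
  have hV' : ∀ z, ‖z‖ < 1 → direction z = csqrt z :=
    fun z hz => if_neg (not_mem_ball_three (by linarith))
  rcases mem_domain_iff.1 hw with hw | hw | ⟨x, hx, hw⟩
  · have hd := hasDerivAt_map_of_mem_ball_three (P := P) hw
    refine ⟨hd.differentiableAt, span_singleton_eq_of_sq_eq (k := 4) (by norm_num) ?_⟩
    have hm : P.map w ∈ Metric.ball (0 : ℂ) 1 :=
      image_map_ball_three (P := P) ▸ mem_image_of_mem _ hw
    rw [hV' _ (mem_ball_zero_iff.1 hm), csqrt_sq, hd.deriv, direction, if_pos hw,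
      map_of_mem_ball_three hw]
    push_cast
    ring
  · have hd := hasDerivAt_map_of_mem_ball_zero (P := P) hw
    refine ⟨hd.differentiableAt, span_singleton_eq_of_sq_eq (k := 4) (by norm_num) ?_⟩
    have hm : P.map w ∈ Metric.ball (0 : ℂ) 1 :=
      image_map_ball_zero (P := P) ▸ mem_image_of_mem _ hw
    rw [hV' _ (mem_ball_zero_iff.1 hm), csqrt_sq, hd.deriv,
      hV' w ((mem_ball_zero_iff.1 hw).trans (by norm_num)), mul_pow, csqrt_sq,
      map_of_mem_ball_zero hw]
    push_cast
    ring
  · have hd := hasDerivAt_map_of_mem_tile hx hw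
    have hr := P.radius_pos x hx
    have hr' : (P.radius x : ℂ) ≠ 0 := by exact_mod_cast hr.ne'
    have hs := csqrt_ne_zero h0
    refine ⟨hd.differentiableAt, span_singleton_eq_of_sq_eq
      (k := 1 / (4 * P.radius x ^ 2)) (by positivity) ?_⟩
    have hm : P.map w ∈ Metric.ball (3 : ℂ) 1 := image_map_tile hx ▸ mem_image_of_mem _ hw
    have hdir : direction (P.map w) = 1 := if_pos hm
    rw [hdir, hd.deriv,
      hV' w (norm_of_mem_closedTile hx (tile_subset_closedTile hw)).2]
    push_cast
    field_simp
    ring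

theorem isInvariant_lineField : P.lineField.IsInvariant P.boxMapping := by
  constructor
  · ext w
    constructor
    · rintro ⟨hw, hK, h⟩
      refine ⟨mem_K_iff.2 ⟨hw, hK⟩, ?_⟩
      -- For `n = 0`: since `0` is fixed, `w = 0` would force `P.map w = 0`.
      rintro (_ | n)
      · intro h0
        apply h 0
        change P.map w = 0
        change w = 0 at h0
        rw [h0, map_zero]
      · exact h n
    · rintro ⟨hK, h⟩
      exact ⟨(mem_K_iff.1 hK).1, (mem_K_iff.1 hK).2, fun n => h (n + 1)⟩
  · rintro w ⟨hK, h⟩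
    obtain ⟨hd, hspan⟩ := direction_map (mem_K_iff.1 hK).1 (h 0)
    change (Submodule.span ℝ {direction w}).map _ = Submodule.span ℝ {direction (P.map w)}
    rw [Submodule.map_span, image_singleton, ← hspan]
    congr 2
    change fderiv ℝ P.map w (direction w) = _
    rw [hd.fderiv_restrictScalars ℝ]
    simp [mul_comm]

end DiskPacking
end Lattes

/-! ### Moduli, no permutation, non-renormalizability, infinitely many pieces. -/

namespace Lattes

open ComplexBoxMapping

namespace DiskPacking

variable {P : DiskPacking} {x : ℂ}

/-- Each piece is surrounded in the unit disk by a round annulus with radius ratio `2`. For a tile,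
`|z² - x²| = |z + x||z - x| ≤ 2r` puts it inside radius `2r` about `x²`, and `norm_sq_add_lt` leaves
room up to `4r`. -/
theorem modulus_bound_of_mem_innerPieces {B : Set ℂ} (hB : B ∈ P.innerPieces) :
    ENNReal.ofReal (1 / (4 * Real.pi)) ≤ modulus (Metric.ball 0 1 \ closure B) := by
  have hpi := Real.pi_pos
  rcases hB with rfl | ⟨x, hx, rfl⟩
  · rw [closure_ball _ (by norm_num)]
    refine le_trans (ENNReal.ofReal_le_ofReal (le_of_eq ?_))
      (ofReal_div_le_modulus (p := 0) (r := 1 / 4) (R := 1 / 2) (by norm_num) (by norm_num) ?_ ?_)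
    · field_simp
      norm_num
    · exact fun h => h.2 (Metric.mem_closedBall_self (by norm_num))
    · intro z hz hz'
      rw [sub_zero] at hz hz'
      refine ⟨mem_ball_zero_iff.2 (by linarith), fun h => ?_⟩
      rw [mem_closedBall_zero_iff] at h
      linarith
  · have hr := P.radius_pos x hx
    have hxx := P.closedBall_subset x hx (Metric.mem_closedBall_self hr.le)
    have hroom := P.norm_sq_add_lt x hx
    rw [closure_tile hx]
    refine le_trans (ENNReal.ofReal_le_ofReal (le_of_eq ?_))
      (ofReal_div_le_modulus (p := x ^ 2) (r := 2 * P.radius x) (R := 4 * P.radius x)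
        (by linarith) (by linarith) ?_ ?_)
    · field_simp
      norm_num
    · exact fun h => h.2 ⟨x, Metric.mem_closedBall_self hr.le, rfl⟩
    · intro w hw hw'
      constructor
      · rw [mem_ball_zero_iff]
        have h1 := norm_sub_norm_le w (x ^ 2)
        rw [norm_pow] at h1
        linarith
      · rintro ⟨z, hz, rfl⟩
        have hz1 := (P.closedBall_subset x hx hz).2.2
        rw [mem_closedBall_iff_norm] at hz
        have h1 : ‖z ^ 2 - x ^ 2‖ ≤ 2 * P.radius x := by
          rw [sq_sub_sq, norm_mul]
          have h2 : ‖z + x‖ ≤ 2 := (norm_add_le z x).trans (by linarith [hxx.2.2])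
          exact mul_le_mul h2 hz (norm_nonneg _) (by norm_num)
        simp only at hw
        linarith

theorem le_m_of_mem {y : ℂ} (hy : y ∈ P.domain) (hy1 : y ∈ Metric.ball (0 : ℂ) 1) :
    ENNReal.ofReal (1 / (4 * Real.pi)) ≤ P.boxMapping.m y := by
  have h : y ∈ ⋃₀ P.innerPieces := domain_inter_ball_zero ▸ ⟨hy, hy1⟩
  obtain ⟨B, hB, hyB⟩ := h
  have h1 : connectedComponentIn P.boxMapping.V y = Metric.ball 0 1 :=
    connectedComponentIn_eq_of_mem_components
      (components_range.symm ▸ (Or.inr rfl : Metric.ball (0 : ℂ) 1 ∈ _)) hy1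
  have h2 : connectedComponentIn P.boxMapping.U y = B := by
    refine connectedComponentIn_eq_of_mem_components ?_ hyB
    change B ∈ components P.domain
    rw [components_domain, pieces_eq]
    exact Or.inr hB
  rw [m, h1, h2]
  exact modulus_bound_of_mem_innerPieces hB

theorem mem_ball_zero_or_map_mem {y : ℂ} (hy : y ∈ P.boxMapping.K) :
    y ∈ Metric.ball (0 : ℂ) 1 ∨ P.map y ∈ Metric.ball (0 : ℂ) 1 := by
  rcases K_subset_V hy with h | h
  · exact Or.inr (image_map_ball_three (P := P) ▸ mem_image_of_mem _ h)
  · exact Or.inl h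

/-- Of two consecutive orbit points, one lies in the unit disk, where `m` is at least `1/(4π)`; half
of this bound serves as `δ`, as the inequality must be strict. -/
theorem K_eq_KWellInside : P.boxMapping.K = P.boxMapping.KWellInside := by
  have hpi := Real.pi_pos
  apply Subset.antisymm
  · intro y hy
    rw [KWellInside, mem_iUnion]
    refine ⟨⟨1 / (8 * Real.pi), by positivity⟩, hy, ?_⟩
    have hlt : ENNReal.ofReal (1 / (8 * Real.pi)) < ENNReal.ofReal (1 / (4 * Real.pi)) := by
      rw [ENNReal.ofReal_lt_ofReal_iff (by positivity)]
      apply one_div_lt_one_div_of_lt <;> linarith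
    refine hlt.trans_le (le_limsup_of_frequently_le ?_)
    rw [frequently_atTop]
    intro n
    have hn := iterate_mem_K hy n
    have hn1 := iterate_mem_K hy (n + 1)
    rcases mem_ball_zero_or_map_mem hn with h | h
    · exact ⟨n, le_rfl, le_m_of_mem (mem_K_iff.1 hn).1 h⟩
    · refine ⟨n + 1, n.le_succ, le_m_of_mem (mem_K_iff.1 hn1).1 ?_⟩
      rw [Function.iterate_succ_apply']
      exact h
  · exact iUnion_subset fun δ => sep_subset _ _

/-- The point is on the branch cut, which no tile meets, and outside the central disk. -/
theorem not_mem_domain : (-1 / 2 : ℂ) ∉ P.domain := by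
  have hn : ‖(-1 / 2 : ℂ)‖ = 1 / 2 := by norm_num
  rw [mem_domain_iff]
  rintro (h | h | ⟨x, hx, h⟩)
  · exact not_mem_ball_three (by rw [hn]; norm_num) h
  · rw [mem_ball_zero_iff, hn] at h
    norm_num at h
  · have := closedTile_subset_slitPlane hx (tile_subset_closedTile h)
    rw [Complex.mem_slitPlane_iff] at this
    norm_num at this

/-- Every component covers the unit disk, hence the hole `-1/2`, after one step, or two steps for a
tile. -/
theorem noPermutation : P.boxMapping.NoPermutation := by
  have h1 : (-1 / 2 : ℂ) ∈ Metric.ball (0 : ℂ) 1 := by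
    rw [mem_ball_zero_iff]
    norm_num
  have hV : (-1 / 2 : ℂ) ∈ P.boxMapping.V := Or.inr h1
  have onto : ∀ B ∈ P.pieces, P.map '' B = Metric.ball 0 1 →
      ∃ n, (P.boxMapping.iterImage n B \ P.boxMapping.U).Nonempty := by
    intro B hB h
    obtain ⟨z, hz, hzw⟩ : (-1 / 2 : ℂ) ∈ P.map '' B := h ▸ h1
    refine ⟨1, -1 / 2, ⟨z, ⟨hz, ⟨B, hB, hz⟩, ?_⟩, hzw⟩, not_mem_domain⟩
    change P.map z ∈ P.boxMapping.V
    rw [hzw]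
    exact hV
  change ∀ B ∈ components P.domain, _
  rw [components_domain]
  intro B hB
  rcases id hB with (rfl | rfl) | ⟨x, hx, rfl⟩
  · exact onto _ hB image_map_ball_three
  · exact onto _ hB image_map_ball_zero
  · obtain ⟨z, hz, hzw⟩ : (-1 / 2 : ℂ) ∈ P.map '' Metric.ball 3 1 :=
      image_map_ball_three (P := P) ▸ h1
    obtain ⟨y, hy, hyz⟩ : z ∈ P.map '' P.tile x := image_map_tile hx ▸ hz
    refine ⟨2, -1 / 2, ⟨y, ⟨hy, ⟨_, hB, hy⟩, ?_⟩, ?_⟩, not_mem_domain⟩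
    · change P.map y ∈ P.domain ∩ P.map ⁻¹' P.boxMapping.V
      rw [hyz]
      refine ⟨mem_domain_iff.2 (Or.inl hz), ?_⟩
      rw [mem_preimage, hzw]
      exact hV
    · change P.map (P.map y) = _
      rw [hyz, hzw]

theorem iterate_map_three (n : ℕ) : P.map^[n + 1] 3 = 0 := by
  rw [Function.iterate_succ_apply, map_three, Function.iterate_fixed map_zero]

/-- All forward iterates of `3` equal `0`, while a puzzle piece containing `3` stays in `ball 3 1`.
One return (`k = 1`) is already impossible. -/
theorem not_isRenormalizable : ¬ P.boxMapping.IsRenormalizable := by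
  rintro ⟨s, hs, n, W, ⟨y, hy, rfl⟩, c, hc, hcW, h⟩
  have hc3 : c = 3 := by
    have : c ∈ ({3} : Set ℂ) := crit_eq (P := P) ▸ hc
    exact this
  subst hc3
  have h1 := (h 1).2
  obtain ⟨k, rfl⟩ : ∃ k, s = k + 1 := ⟨s - 1, by omega⟩
  change P.map^[1 * (k + 1)] 3 ∈ _ at h1
  rw [one_mul, iterate_map_three, connectedComponentIn_eq hcW] at h1
  have h2 := connectedComponentIn_mono (3 : ℂ) (preimageV_subset (F := P.boxMapping) n) h1
  have h3 : connectedComponentIn P.boxMapping.V 3 = Metric.ball 3 1 :=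
    connectedComponentIn_eq_of_mem_components
      (components_range.symm ▸ (Or.inl rfl : Metric.ball (3 : ℂ) 1 ∈ _))
      (Metric.mem_ball_self one_pos)
  rw [h3] at h2
  exact not_mem_ball_three (by simp) h2

/-- Finitely many closed pieces form a compact subset of the open disk. Its complement there is open
and null, hence empty, which would make the open disk compact. -/
theorem infinite_innerPieces : P.innerPieces.Infinite := by
  intro hfin
  have hclosed : IsClosed (⋃ B ∈ P.innerPieces, closure B) :=
    hfin.isClosed_biUnion fun B _ => isClosed_closure
  have hcomp : IsCompact (⋃ B ∈ P.innerPieces, closure B) :=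
    (isCompact_closedBall (0 : ℂ) 1).of_isClosed_subset hclosed (iUnion₂_subset fun B hB =>
      (isJordanDisk_of_mem_innerPieces hB).2.trans Metric.ball_subset_closedBall)
  have hsub : (⋃ B ∈ P.innerPieces, closure B) ⊆ Metric.ball 0 1 :=
    iUnion₂_subset fun B hB => (isJordanDisk_of_mem_innerPieces hB).2
  have hnull : volume (Metric.ball 0 1 \ ⋃ B ∈ P.innerPieces, closure B) = 0 := by
    refine measure_mono_null ?_ (volume_ball_diff_domain (P := P))
    rintro w ⟨hw, hw'⟩
    refine ⟨hw, fun h => hw' ?_⟩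
    obtain ⟨B, hB, hwB⟩ : w ∈ ⋃₀ P.innerPieces := domain_inter_ball_zero ▸ ⟨h, hw⟩
    exact mem_biUnion hB (subset_closure hwB)
  have hempty := (Metric.isOpen_ball.sdiff hclosed).measure_eq_zero_iff volume |>.1 hnull
  have heq : (⋃ B ∈ P.innerPieces, closure B) = Metric.ball 0 1 :=
    hsub.antisymm (sdiff_eq_empty.1 hempty)
  rw [heq] at hcomp
  have h1 : (1 : ℂ) ∈ closure (Metric.ball (0 : ℂ) 1) := by
    rw [closure_ball _ one_ne_zero]
    simp
  rw [hcomp.isClosed.closure_eq] at h1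
  simp at h1

end DiskPacking
end Lattes

/-! ### The area estimate for orbits avoiding the critical point. -/

namespace Lattes

open ComplexBoxMapping
open scoped Pointwise

namespace DiskPacking

variable {P : DiskPacking} {x : ℂ}

theorem two_mul_volume_rightAnnulus :
    2 * volume rightAnnulus + ENNReal.ofReal (1 / 2) ^ 2 * NNReal.pi ≤ NNReal.pi := by
  have hm := isOpen_rightAnnulus.measurableSet
  have hd1 : Disjoint rightAnnulus (-rightAnnulus) := by
    rw [Set.disjoint_left]
    intro z hz hz'
    have h1 := hz.1
    have h2 := hz'.1
    rw [Complex.neg_re] at h2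
    linarith
  have hd2 : Disjoint (rightAnnulus ∪ -rightAnnulus) (Metric.ball 0 (1 / 2)) := by
    rw [Set.disjoint_left]
    intro z hz hz'
    rw [mem_ball_zero_iff] at hz'
    rcases hz with hz | hz
    · exact hz.2.1.not_gt hz'
    · have := hz.2.1
      rw [norm_neg] at this
      exact this.not_gt hz'
  have hneg : volume (-rightAnnulus) = volume rightAnnulus := Measure.measure_neg _ _
  have h : volume ((rightAnnulus ∪ -rightAnnulus) ∪ Metric.ball 0 (1 / 2)) ≤
      volume (Metric.ball (0 : ℂ) 1) := by
    refine measure_mono ?_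
    rintro z ((hz | hz) | hz)
    · exact mem_ball_zero_iff.2 hz.2.2
    · have := hz.2.2
      rw [norm_neg] at this
      exact mem_ball_zero_iff.2 this
    · exact Metric.ball_subset_ball (by norm_num) hz
  rw [measure_union hd2 Metric.isOpen_ball.measurableSet, measure_union hd1 hm.neg, hneg,
    ← two_mul, Complex.volume_ball, Complex.volume_ball] at h
  simpa using h

/-- The packed disks are disjoint in the half annulus, whose area is at most `π (1 - 1/4) / 2`. -/
theorem tsum_radius_sq_le :
    ∑' x : P.centers, ENNReal.ofReal (P.radius x) ^ 2 ≤ ENNReal.ofReal (3 / 8) := by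
  have h : (∑' x : P.centers, ENNReal.ofReal (P.radius x) ^ 2) * NNReal.pi ≤
      volume rightAnnulus := by
    rw [← ENNReal.tsum_mul_right]
    calc ∑' x : P.centers, ENNReal.ofReal (P.radius x) ^ 2 * NNReal.pi
        = ∑' x : P.centers, volume (Metric.closedBall (x : ℂ) (P.radius x)) := by
          simp_rw [Complex.volume_closedBall]
      _ = volume (⋃ x ∈ P.centers, Metric.closedBall x (P.radius x)) :=
          (measure_biUnion P.countable P.pairwiseDisjoint
            fun _ _ => Metric.isClosed_closedBall.measurableSet).symm
      _ ≤ volume rightAnnulus := measure_mono (iUnion₂_subset P.closedBall_subset)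
  set S := ∑' x : P.centers, ENNReal.ofReal (P.radius x) ^ 2
  have h2 : (2 * S + ENNReal.ofReal (1 / 2) ^ 2) * NNReal.pi ≤ 1 * NNReal.pi := by
    rw [add_mul, one_mul, mul_assoc]
    exact le_trans (by gcongr) two_mul_volume_rightAnnulus
  have hpi : (NNReal.pi : ENNReal) ≠ 0 := by
    simpa using NNReal.pi_ne_zero
  rw [ENNReal.mul_le_mul_iff_left hpi ENNReal.coe_ne_top] at h2
  have hS : S ≠ ⊤ := by
    rintro hS
    rw [hS] at h2
    simp at h2
  rw [← ENNReal.ofReal_toReal hS] at h2 ⊢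
  apply ENNReal.ofReal_le_ofReal
  rw [← ENNReal.ofReal_pow (by norm_num), ← ENNReal.ofReal_ofNat,
    ← ENNReal.ofReal_mul (by norm_num), ← ENNReal.ofReal_add (by positivity) (by norm_num),
    ENNReal.ofReal_le_one] at h2
  linarith

/-- The non-escaping points whose orbit avoids the `ε`-neighborhood of the critical point. -/
def avoiding (P : DiskPacking) (ε : ℝ) : Set ℂ :=
  {w ∈ P.boxMapping.K | ∀ n : ℕ, P.map^[n] w ∉ Metric.ball (3 : ℂ) ε}

/-- The avoiding points in the disk about the critical point, in the coordinate `z - 3`. -/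
def avoidingOuter (P : DiskPacking) (ε : ℝ) : Set ℂ :=
  {z | ‖z‖ < 1 ∧ 3 + z ∈ P.avoiding ε}

/-- The avoiding points in the unit disk, in the coordinate `√w`. -/
def avoidingInner (P : DiskPacking) (ε : ℝ) : Set ℂ :=
  {z | 0 < z.re ∧ ‖z‖ < 1 ∧ z ^ 2 ∈ P.avoiding ε}

variable {ε : ℝ}

theorem map_mem_avoiding {w : ℂ} (hw : w ∈ P.avoiding ε) : P.map w ∈ P.avoiding ε :=
  ⟨(mem_K_iff.1 hw.1).2, fun n => hw.2 (n + 1)⟩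

/-- In the charts, the map on `ball 3 1` is `z ↦ ±z`, so the outer set is covered by two copies of
the inner one; removing `ball 0 ε` is where avoidance enters. -/
theorem avoidingOuter_subset : P.avoidingOuter ε ⊆
    (P.avoidingInner ε \ Metric.ball 0 ε) ∪ -(P.avoidingInner ε \ Metric.ball 0 ε) ∪
      {z | z.re = 0} := by
  rintro z ⟨hz, hA⟩
  have h0 : z ∉ Metric.ball (0 : ℂ) ε := by
    have := hA.2 0
    rw [mem_ball_zero_iff]
    rwa [Function.iterate_zero, id, mem_ball_iff_norm, add_sub_cancel_left] at this
  have h1 : z ^ 2 ∈ P.avoiding ε := by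
    have := map_mem_avoiding hA
    rwa [map_of_mem_ball_three (by rwa [mem_ball_iff_norm, add_sub_cancel_left]),
      add_sub_cancel_left] at this
  rcases lt_trichotomy z.re 0 with h | h | h
  · refine Or.inl (Or.inr ⟨⟨by simpa using h, by rwa [norm_neg], by rwa [neg_sq]⟩, ?_⟩)
    rw [mem_ball_zero_iff] at h0 ⊢
    rwa [norm_neg]
  · exact Or.inr h
  · exact Or.inl (Or.inl ⟨⟨h, hz, h1⟩, h0⟩)

theorem avoidingInner_inter_ball_zero_subset :
    P.avoidingInner ε ∩ Metric.ball 0 (1 / 2) ⊆ (1 / 2 : ℝ) • P.avoidingInner ε := by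
  rintro z ⟨⟨hre, -, hA⟩, hz⟩
  rw [mem_ball_zero_iff] at hz
  refine ⟨2 * z, ⟨by simpa using hre, ?_, ?_⟩, ?_⟩
  · rw [norm_mul, Complex.norm_ofNat]
    linarith
  · have h := map_mem_avoiding hA
    rw [map_of_mem_ball_zero] at h
    · convert h using 1
      ring
    · rw [mem_ball_zero_iff, norm_pow]
      nlinarith [norm_nonneg z]
  · simp

/-- Halving `z` is the inverse branch of `w ↦ 4w`. The new orbit point lies in the unit disk, far
from `ball 3 ε` as `ε ≤ 1`. -/
theorem half_smul_avoidingInner_subset (hε : ε ≤ 1) :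
    (1 / 2 : ℝ) • P.avoidingInner ε ⊆ P.avoidingInner ε := by
  rintro _ ⟨z, ⟨hre, hz, hA⟩, rfl⟩
  have hn : ‖(1 / 2 : ℝ) • z‖ = ‖z‖ / 2 := by
    rw [norm_smul]
    norm_num
    ring
  have hn2 : ‖((1 / 2 : ℝ) • z) ^ 2‖ < 1 / 4 := by
    rw [norm_pow, hn]
    nlinarith [norm_nonneg z]
  have hmem := mem_ball_zero_iff.2 hn2
  have hmap : P.map (((1 / 2 : ℝ) • z) ^ 2) = z ^ 2 := by
    rw [map_of_mem_ball_zero hmem, Complex.real_smul]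
    push_cast
    ring
  refine ⟨by simpa using hre, by simp only [hn]; linarith, mem_K_iff.2 ⟨?_, ?_⟩, ?_⟩
  · exact mem_domain_iff.2 (Or.inr (Or.inl hmem))
  · change P.map _ ∈ _
    rw [hmap]
    exact hA.1
  · rintro (_ | n)
    · refine fun h => not_mem_ball_three (w := ((1 / 2 : ℝ) • z) ^ 2) (by linarith)
        (Metric.ball_subset_ball hε h)
    · rw [Function.iterate_succ_apply, hmap]
      exact hA.2 n

theorem avoidingInner_inter_ball_subset (hx : x ∈ P.centers) :
    P.avoidingInner ε ∩ Metric.ball x (P.radius x) ⊆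
      (fun z => x + z) '' (P.radius x • P.avoidingOuter ε) := by
  rintro z ⟨⟨hre, -, hA⟩, hz⟩
  have hr := P.radius_pos x hx
  have hr' : (P.radius x : ℂ) ≠ 0 := by exact_mod_cast hr.ne'
  refine ⟨z - x, ⟨(z - x) / P.radius x, ⟨?_, ?_⟩, ?_⟩, by simp⟩
  · rw [norm_div, Complex.norm_real, Real.norm_of_nonneg hr.le, div_lt_one hr]
    exact mem_ball_iff_norm.1 hz
  · have h := map_mem_avoiding hA
    rwa [map_of_mem_tile hx ⟨z, hz, rfl⟩, csqrt_of_sq hre] at h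
  · simp only [Complex.real_smul]
    field_simp

theorem volume_real_smul (r : ℝ) (s : Set ℂ) :
    volume (r • s) = ENNReal.ofReal (r ^ 2) * volume s := by
  rw [Measure.addHaar_smul, Complex.finrank_real_complex, abs_of_nonneg (sq_nonneg r)]

/-- Split the inner set along the central disk, a half-scale copy, and the packed disks, each
holding at most an `r`-scaled copy of the outer set. -/
theorem volume_avoidingInner_le : volume (P.avoidingInner ε) ≤
    ENNReal.ofReal (1 / 4) * volume (P.avoidingInner ε) +
      ENNReal.ofReal (3 / 8) * volume (P.avoidingOuter ε) := by
  have hsub : P.avoidingInner ε ⊆ (P.avoidingInner ε ∩ Metric.ball 0 (1 / 2) ∪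
      ⋃ x ∈ P.centers, P.avoidingInner ε ∩ Metric.ball x (P.radius x)) ∪
      (Metric.sphere 0 (1 / 2) ∪
        rightAnnulus \ ⋃ x ∈ P.centers, Metric.ball x (P.radius x)) := by
    intro z hz
    rcases lt_trichotomy ‖z‖ (1 / 2) with h | h | h
    · exact Or.inl (Or.inl ⟨hz, mem_ball_zero_iff.2 h⟩)
    · exact Or.inr (Or.inl (mem_sphere_zero_iff_norm.2 h))
    · by_cases hx : z ∈ ⋃ x ∈ P.centers, Metric.ball x (P.radius x)
      · simp only [mem_iUnion, exists_prop] at hx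
        obtain ⟨x, hx, hzx⟩ := hx
        exact Or.inl (Or.inr (mem_biUnion hx ⟨hz, hzx⟩))
      · exact Or.inr (Or.inr ⟨⟨hz.1, h, hz.2.1⟩, hx⟩)
  have hnull : volume (Metric.sphere (0 : ℂ) (1 / 2) ∪
      rightAnnulus \ ⋃ x ∈ P.centers, Metric.ball x (P.radius x)) = 0 :=
    measure_union_null (Measure.addHaar_sphere_of_ne_zero _ _ (by norm_num))
      volume_rightAnnulus_diff_balls
  have h1 : volume (P.avoidingInner ε ∩ Metric.ball 0 (1 / 2)) ≤
      ENNReal.ofReal (1 / 4) * volume (P.avoidingInner ε) := by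
    refine (measure_mono avoidingInner_inter_ball_zero_subset).trans ?_
    rw [volume_real_smul]
    norm_num
  have h2 : volume (⋃ x ∈ P.centers, P.avoidingInner ε ∩ Metric.ball x (P.radius x)) ≤
      ENNReal.ofReal (3 / 8) * volume (P.avoidingOuter ε) := by
    calc _ ≤ ∑' x : P.centers, volume (P.avoidingInner ε ∩ Metric.ball x (P.radius x)) :=
          measure_biUnion_le _ P.countable _
      _ ≤ ∑' x : P.centers,
            ENNReal.ofReal (P.radius x) ^ 2 * volume (P.avoidingOuter ε) := by
          refine ENNReal.tsum_le_tsum fun x => ?_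
          refine (measure_mono (avoidingInner_inter_ball_subset x.2)).trans ?_
          rw [image_add_left, measure_preimage_add, volume_real_smul,
            ENNReal.ofReal_pow (P.radius_pos x x.2).le]
      _ ≤ _ := by
          rw [ENNReal.tsum_mul_right]
          gcongr
          exact tsum_radius_sq_le
  calc volume (P.avoidingInner ε) ≤ _ := (measure_mono hsub).trans (measure_union_le _ _)
    _ ≤ _ := by
      rw [hnull, add_zero]
      exact (measure_union_le _ _).trans (add_le_add h1 h2)

/-- With `d` and `e` the inner areas inside and outside `ball 0 ε`, the two bounds give `d + e ≤ (d
+ e)/4 + (3/8)(2e)`, that is, `(3/4) d ≤ 0`. Finiteness of area permits the cancellation. -/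
theorem volume_avoidingInner_inter_ball :
    volume (P.avoidingInner ε ∩ Metric.ball 0 ε) = 0 := by
  have hsub : P.avoidingInner ε ⊆ Metric.ball 0 1 := fun z hz => mem_ball_zero_iff.2 hz.2.1
  have hfin : volume (P.avoidingInner ε) ≠ ⊤ := ((measure_mono hsub).trans_lt measure_ball_lt_top).ne
  have h1 := volume_avoidingInner_le (P := P) (ε := ε)
  have h2 : volume (P.avoidingOuter ε) ≤ 2 * volume (P.avoidingInner ε \ Metric.ball 0 ε) := by
    calc _ ≤ _ := measure_mono avoidingOuter_subset
      _ ≤ _ := measure_union_le _ _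
      _ ≤ _ := add_le_add (measure_union_le _ _) le_rfl
      _ = _ := by
        rw [volume_re_eq_zero, add_zero, Measure.measure_neg, two_mul]
  have h3 := measure_inter_add_sdiff (μ := volume) (P.avoidingInner ε)
    (Metric.isOpen_ball (x := (0 : ℂ)) (ε := ε)).measurableSet
  have hd : volume (P.avoidingInner ε ∩ Metric.ball 0 ε) ≠ ⊤ :=
    measure_ne_top_of_subset inter_subset_left hfin
  have he : volume (P.avoidingInner ε \ Metric.ball 0 ε) ≠ ⊤ :=
    measure_ne_top_of_subset sdiff_subset hfin
  have h4 := h1.trans (add_le_add le_rfl (mul_le_mul_right h2 (ENNReal.ofReal (3 / 8))))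
  rw [← h3] at h4
  lift volume (P.avoidingInner ε ∩ Metric.ball 0 ε) to NNReal using hd with d
  lift volume (P.avoidingInner ε \ Metric.ball 0 ε) to NNReal using he with e
  have h5 : d + e ≤ Real.toNNReal (1 / 4) * (d + e) + Real.toNNReal (3 / 8) * (2 * e) := by
    simp only [ENNReal.ofReal] at h4
    exact_mod_cast h4
  rw [← NNReal.coe_le_coe] at h5
  push_cast at h5
  rw [Real.coe_toNNReal _ (by norm_num), Real.coe_toNNReal _ (by norm_num)] at h5
  have h6 : (d : ℝ) = 0 := by
    have := d.coe_nonneg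
    linarith
  exact_mod_cast h6

/-- Repeated halving places a scaled copy of the whole set inside its null part near `0`. -/
theorem volume_avoidingInner (hε : 0 < ε) (hε1 : ε ≤ 1) : volume (P.avoidingInner ε) = 0 := by
  have hiter : ∀ n : ℕ, ((1 / 2 : ℝ) ^ n) • P.avoidingInner ε ⊆ P.avoidingInner ε := by
    intro n
    induction n with
    | zero => simp
    | succ n ih =>
      rw [pow_succ', mul_smul]
      exact (smul_set_mono ih).trans (half_smul_avoidingInner_subset hε1)
  obtain ⟨n, hn⟩ := exists_pow_lt_of_lt_one hε (by norm_num : (1 / 2 : ℝ) < 1)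
  have h : ((1 / 2 : ℝ) ^ n) • P.avoidingInner ε ⊆ P.avoidingInner ε ∩ Metric.ball 0 ε := by
    refine subset_inter (hiter n) ?_
    rintro _ ⟨z, ⟨-, hz, -⟩, rfl⟩
    rw [mem_ball_zero_iff]
    simp only [norm_smul, norm_pow]
    norm_num at hn ⊢
    nlinarith [norm_nonneg z, pow_pos (by norm_num : (0 : ℝ) < 1 / 2) n]
  have h0 := measure_mono_null h volume_avoidingInner_inter_ball
  rw [volume_real_smul, mul_eq_zero] at h0
  refine h0.resolve_left ?_
  rw [ENNReal.ofReal_eq_zero, not_le]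
  positivity

theorem volume_avoiding (hε : 0 < ε) (hε1 : ε ≤ 1) : volume (P.avoiding ε) = 0 := by
  have hi := volume_avoidingInner (P := P) hε hε1
  have ho : volume (P.avoidingOuter ε) = 0 := by
    have h := measure_mono_null (sdiff_subset (t := Metric.ball 0 ε)) hi
    refine measure_mono_null avoidingOuter_subset
      (measure_union_null (measure_union_null h ?_) volume_re_eq_zero)
    rwa [Measure.measure_neg]
  have ho' := volume_image_eq_zero (g := fun z => 3 + z) (by fun_prop) ho
  have hi' := volume_image_eq_zero (g := fun z => z ^ 2) (by fun_prop) hi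
  refine measure_mono_null ?_ (measure_union_null (measure_union_null ho' hi') volume_im_eq_zero)
  intro w hw
  rcases K_subset_V hw.1 with h | h
  · exact Or.inl (Or.inl ⟨w - 3, ⟨mem_ball_iff_norm.1 h, by simpa using hw⟩, by simp⟩)
  · by_cases him : w ∈ {w : ℂ | w.im = 0}
    · exact Or.inr him
    · refine Or.inl (Or.inr ⟨csqrt w, ⟨re_csqrt_pos (mem_slitPlane_of_im_ne_zero him), ?_, ?_⟩,
        csqrt_sq w⟩)
      · rw [mem_ball_zero_iff, ← norm_csqrt_sq] at h
        nlinarith [norm_nonneg (csqrt w)]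
      · rwa [csqrt_sq]

/-- A puzzle neighbourhood is open, so it contains a ball of radius `1/(n + 1)` about `3`; take the
union over `n`. -/
theorem volume_KOffCrit : volume P.boxMapping.KOffCrit = 0 := by
  have h : ∀ n : ℕ, volume (P.avoiding (1 / (n + 1))) = 0 := by
    intro n
    refine volume_avoiding Nat.one_div_pos_of_nat ?_
    rw [div_le_one (by positivity)]
    linarith [n.cast_nonneg (α := ℝ)]
  refine measure_mono_null ?_ (measure_iUnion_null h)
  rintro w ⟨hw, W, hW, hdisj⟩
  have h3 : (3 : ℂ) ∈ W := hW.2.1 ((crit_eq (P := P)).ge (mem_singleton 3))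
  obtain ⟨ε, hε, hball⟩ := Metric.isOpen_iff.1 hW.isOpen 3 h3
  obtain ⟨n, hn⟩ := exists_nat_one_div_lt hε
  refine mem_iUnion.2 ⟨n, hw, fun k hk => ?_⟩
  have : P.map^[k] w ∈ P.boxMapping.orbit w ∩ W :=
    ⟨⟨k, rfl⟩, hball (Metric.ball_subset_ball hn.le hk)⟩
  rw [hdisj] at this
  exact this

theorem isDynamicallyNatural : P.boxMapping.IsDynamicallyNatural :=
  ⟨noPermutation, volume_KOffCrit, K_eq_KWellInside⟩

end DiskPacking
end Lattes

/-! ### Assembly. -/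

theorem proposition12p1 :
    ∃ F : ComplexBoxMapping,
      F.IsDynamicallyNatural ∧ ¬ F.IsRenormalizable ∧
      0 < volume F.K ∧
      (∃ μ : LineField F.K, μ.IsInvariant F ∧ volume (F.K \ μ.E) = 0) ∧
      ∃ (c : ℂ) (V V' U' : Set ℂ),
        -- the unique critical point is strictly pre-fixed
        F.Crit = {c} ∧ F.f c ∈ F.U ∧ F.f (F.f c) = F.f c ∧ F.f c ≠ c ∧
        -- the components of the range
        V ≠ V' ∧ components F.V = {V, V'} ∧
        F.U ∩ V = V ∧ c ∈ V ∧
        U' ∈ components (F.U ∩ V') ∧ F.f c ∈ U' ∧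
        -- infinitely many components of the domain tile the second component of the range
        (components (F.U ∩ V')).Infinite ∧ volume (V' \ F.U) = 0 ∧
        -- the images of these components
        F.f '' U' = V' ∧
        ∀ U'' ∈ components (F.U ∩ V'), U'' ≠ U' → F.f '' U'' = V := by
  obtain ⟨P⟩ := Lattes.exists_diskPacking
  have h0 : P.map 3 = 0 := Lattes.DiskPacking.map_three
  have h00 : P.map 0 = 0 := Lattes.DiskPacking.map_zero
  refine ⟨P.boxMapping, Lattes.DiskPacking.isDynamicallyNatural,
    Lattes.DiskPacking.not_isRenormalizable, Lattes.DiskPacking.volume_K_pos,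
    ⟨P.lineField, Lattes.DiskPacking.isInvariant_lineField,
      Lattes.DiskPacking.volume_K_diff_lineFieldSupport⟩,
    3, Metric.ball 3 1, Metric.ball 0 1, Metric.ball 0 (1 / 4), Lattes.DiskPacking.crit_eq,
    ?_, ?_, ?_, ?_, Lattes.DiskPacking.components_range, ?_, Metric.mem_ball_self one_pos,
    ?_, ?_, ?_, Lattes.DiskPacking.volume_ball_diff_domain,
    Lattes.DiskPacking.image_map_ball_zero, ?_⟩
  · change P.map 3 ∈ P.domain
    rw [h0]
    exact Lattes.DiskPacking.mem_domain_iff.2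
      (Or.inr (Or.inl (Metric.mem_ball_self (by norm_num))))
  · change P.map (P.map 3) = P.map 3
    rw [h0, h00]
  · change P.map 3 ≠ 3
    rw [h0]
    norm_num
  · intro h
    have h1 : (0 : ℂ) ∈ Metric.ball (3 : ℂ) 1 := h ▸ Metric.mem_ball_self one_pos
    exact Lattes.DiskPacking.not_mem_ball_three (by simp) h1
  · exact inter_eq_right.2 fun w hw => Lattes.DiskPacking.mem_domain_iff.2 (Or.inl hw)
  · exact Lattes.DiskPacking.components_domain_inter_ball_zero.symm ▸ Or.inl rfl
  · change P.map 3 ∈ _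
    rw [h0]
    exact Metric.mem_ball_self (by norm_num)
  · exact Lattes.DiskPacking.components_domain_inter_ball_zero.symm ▸
      Lattes.DiskPacking.infinite_innerPieces
  · intro B hB hne
    change B ∈ components (P.domain ∩ Metric.ball 0 1) at hB
    rw [Lattes.DiskPacking.components_domain_inter_ball_zero] at hB
    rcases hB with rfl | ⟨x, hx, rfl⟩
    · exact absurd rfl hne
    · exact Lattes.DiskPacking.image_map_tile hx
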